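/- Let $\mathbb D$ be the open unit disc of $\mathbb C$ and $dA=\frac{dx\,dy}{\pi}$ the normalized area measure on $\mathbb D$. A radial weight is a nonnegative function $\omega\in L^1([0,1))$, extended to $\mathbb D$ by $\omega(z)=\omega(|z|)$, such that $\widehat{\omega}(r)=\int_r^1\omega(s)\,ds>0$ for all $0\le r<1$; put $\widehat\omega(z)=\widehat\omega(|z|)$. A radial weight $\omega$ belongs to $\widehat{\mathcal D}$ if there is $C>0$ with $\widehat\omega(r)\le C\,\widehat\omega\left(\frac{1+r}{2}\right)$ for all $r<1$ sufficiently close to $1$; it belongs to $\widecheck{\mathcal D}$ if there are $K>1$ and $C>1$ with $\widehat\omega(r)\ge C\,\widehat\omega\left(1-\frac{1-r}{K}\right)$ for all $r<1$ sufficiently close to $1$; and $\mathcal D=\widehat{\mathcal D}\cap\widecheck{\mathcal D}$ is the class of doubling weights. For a radial weight $\omega$, let $A^2_\omega$ be the space of analytic functions $f$ in $\mathbb D$ with $\int_{\mathbb D}|f|^2\omega\,dA<\infty$, let $B^\omega_z(\zeta)=\sum_{n\ge0}\frac{(\overline z\zeta)^n}{2\omega_{2n+1}}$, where $\omega_n=\int_0^1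 s^n\omega(s)\,ds$, be its reproducing kernel at $z\in\mathbb D$, and let $$P_\omega(f)(z)=\int_{\mathbb D}f(\zeta)\,\overline{B^\omega_z(\zeta)}\,\omega(\zeta)\,dA(\zeta)$$ be the Bergman projection. For a radial weight $\nu$, let $L^\infty_{\widehat\nu}$ be the space of measurable $f:\mathbb D\to\mathbb C$ with $\|f\|_{\infty,\widehat\nu}=\operatorname{ess\,sup}_{z\in\mathbb D}|f(z)|\widehat\nu(z)<\infty$, and let $H^\infty_{\widehat\nu}$ be its subspace of analytic functions. We say that $P_\omega:L^\infty_{\widehat\nu}\to H^\infty_{\widehat\nu}$ is bounded if there is a constant $C$ such that for every $f\in L^\infty_{\widehat\nu}$ the integral $P_\omega(f)(z)$ converges absolutely for every $z\in\mathbb D$, $P_\omega(f)\in H^\infty_{\widehat\nu}$, and $\|P_\omega(f)\|_{\infty,\widehat\nu}\le C\|f\|_{\infty,\widehat\nu}$. Let $\omega$ and $\nu$ be radial weights such that $P_\omega:L^\infty_{\widehat\nu}\to H^\infty_{\widehat\nu}$ is bounded, and suppose that $\omega\in\widehat{\mathcal D}$ or $\nu\in\widehat{\mathcal D}$. Then both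 $\omega$ and $\nu$ belong to $\mathcal D$. -/

import Mathlib

open MeasureTheory Metric Set Filter Topology
open scoped ENNReal NNReal ComplexConjugate Real

/-- The tail integral `∫_r^1 ω(s) ds`. -/
noncomputable def tail (ω : ℝ → ℝ) (r : ℝ) : ℝ := ∫ s in r..1, ω s

/-- The moment `∫_0^1 s^n ω(s) ds`. -/
noncomputable def moment (ω : ℝ → ℝ) (n : ℕ) : ℝ := ∫ s in (0 : ℝ)..1, s ^ n * ω s

/-- A nonnegative integrable function on `[0,1)`, all of whose tail integrals are positive.
Only the values on `[0,1)` matter; its radial extension to the unit disc is `z ↦ ω ‖z‖`. -/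
structure IsRadialWeight (ω : ℝ → ℝ) : Prop where
  nonneg : ∀ r ∈ Ico (0 : ℝ) 1, 0 ≤ ω r
  integrable : IntegrableOn ω (Ico (0 : ℝ) 1)
  tail_pos : ∀ r ∈ Ico (0 : ℝ) 1, 0 < tail ω r

/-- The upper doubling class. -/
def UpperDoubling (ω : ℝ → ℝ) : Prop :=
  ∃ C : ℝ, 0 < C ∧ ∀ᶠ r in 𝓝[<] (1 : ℝ), tail ω r ≤ C * tail ω ((1 + r) / 2)

/-- The lower doubling class. -/
def LowerDoubling (ω : ℝ → ℝ) : Prop :=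
  ∃ K C : ℝ, 1 < K ∧ 1 < C ∧
    ∀ᶠ r in 𝓝[<] (1 : ℝ), C * tail ω (1 - (1 - r) / K) ≤ tail ω r

/-- The class of doubling weights. -/
def Doubling (ω : ℝ → ℝ) : Prop := UpperDoubling ω ∧ LowerDoubling ω

/-- The area measure of the unit disc, normalized to have mass one: `dA = dx dy / π`. -/
noncomputable def discArea : Measure ℂ :=
  ENNReal.ofReal (1 / π) • (volume : Measure ℂ).restrict (ball 0 1)

/-- Membership in the weighted Bergman space `A²_ω`. -/
def MemBergman (ω : ℝ → ℝ) (f : ℂ → ℂ) : Prop :=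
  DifferentiableOn ℂ f (ball 0 1) ∧ Integrable (fun z => ‖f z‖ ^ 2 * ω ‖z‖) discArea

/-- `k` is the reproducing kernel of `A²_ω` at the point `z`. -/
def IsReproducingKernelAt (ω : ℝ → ℝ) (z : ℂ) (k : ℂ → ℂ) : Prop :=
  MemBergman ω k ∧
    ∀ f, MemBergman ω f → f z = ∫ ζ, f ζ * conj (k ζ) * (ω ‖ζ‖ : ℂ) ∂discArea

/-- The Bergman kernel `B^ω_z(ζ)`. By `isReproducingKernelAt_bergmanKernel` and
`IsReproducingKernelAt.eqOn_bergmanKernel` below, `B^ω_z` is the one and only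
reproducing kernel of `A²_ω` at `z`. -/
noncomputable def bergmanKernel (ω : ℝ → ℝ) (z ζ : ℂ) : ℂ :=
  ∑' n : ℕ, (conj z * ζ) ^ n / ((2 * moment ω (2 * n + 1) : ℝ) : ℂ)

theorem IsRadialWeight.integrable_norm {ω : ℝ → ℝ} (hω : IsRadialWeight ω) :
    IntegrableOn (fun z : ℂ => ω ‖z‖) (ball 0 1) := by
  rw [MeasureTheory.integrableOn_fun_norm_addHaar]
  have h1 : IntegrableOn ω (Ioo (0 : ℝ) 1) := hω.integrable.mono_set Ioo_subset_Ico_self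
  have h2 := h1.bdd_mul (c := 1) (f := fun y : ℝ => y)
    (by fun_prop) (by
      filter_upwards [ae_restrict_mem measurableSet_Ioo] with y hy
      rw [Real.norm_eq_abs, abs_of_pos hy.1]; exact hy.2.le)
  simpa [IntegrableOn, Complex.finrank_real_complex, smul_eq_mul] using h2

theorem integrable_discArea_iff {E : Type*} [NormedAddCommGroup E] {g : ℂ → E} :
    Integrable g discArea ↔ IntegrableOn g (ball 0 1) := by
  unfold discArea IntegrableOn
  rw [integrable_smul_measure]
  · simp [Real.pi_pos]
  · simp

theorem IsRadialWeight.moment_ge {ω : ℝ → ℝ} (hω : IsRadialWeight ω) (n : ℕ) {r : ℝ}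
    (hr : r ∈ Ico (0 : ℝ) 1) : r ^ n * tail ω r ≤ moment ω n := by
  have hI : IntegrableOn ω (Ioc (0 : ℝ) 1) := by
    rw [integrableOn_Ioc_iff_integrableOn_Ioo]
    exact hω.integrable.mono_set Ioo_subset_Ico_self
  have hI' : IntegrableOn (fun s => s ^ n * ω s) (Ioc (0 : ℝ) 1) := by
    refine hI.bdd_mul (c := 1) (by fun_prop) ?_
    filter_upwards [ae_restrict_mem measurableSet_Ioc] with y hy
    rw [norm_pow, Real.norm_eq_abs, abs_of_pos hy.1]
    exact pow_le_one₀ hy.1.le hy.2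
  unfold tail moment
  rw [intervalIntegral.integral_of_le hr.2.le, intervalIntegral.integral_of_le zero_le_one,
    integral_Ioc_eq_integral_Ioo, integral_Ioc_eq_integral_Ioo, ← integral_const_mul]
  have hI2 : IntegrableOn (fun s => s ^ n * ω s) (Ioo (0 : ℝ) 1) :=
    hI'.mono_set Ioo_subset_Ioc_self
  calc ∫ s in Ioo r 1, r ^ n * ω s ≤ ∫ s in Ioo r 1, s ^ n * ω s := by
        refine setIntegral_mono_on ?_ ?_ measurableSet_Ioo ?_
        · exact ((hI.mono_set (Ioo_subset_Ioc_self.trans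
            (Ioc_subset_Ioc_left hr.1))).const_mul _)
        · exact hI2.mono_set (Ioo_subset_Ioo_left hr.1)
        · intro s hs
          have := hω.nonneg s ⟨hr.1.trans hs.1.le, hs.2⟩
          have h2 := hr.1
          have h3 := hs.1.le
          gcongr
    _ ≤ ∫ s in Ioo 0 1, s ^ n * ω s := by
        refine setIntegral_mono_set hI2 ?_ (Ioo_subset_Ioo_left hr.1).eventuallyLE
        filter_upwards [ae_restrict_mem measurableSet_Ioo] with s hs
        exact mul_nonneg (pow_nonneg hs.1.le _) (hω.nonneg s ⟨hs.1.le, hs.2⟩)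

theorem IsRadialWeight.moment_pos {ω : ℝ → ℝ} (hω : IsRadialWeight ω) (n : ℕ) :
    0 < moment ω n := by
  have h : (1 / 2 : ℝ) ∈ Ico (0 : ℝ) 1 := by constructor <;> norm_num
  exact lt_of_lt_of_le (mul_pos (by positivity) (hω.tail_pos _ h)) (hω.moment_ge n h)

theorem IsRadialWeight.summable_kernel {ω : ℝ → ℝ} (hω : IsRadialWeight ω) {x : ℝ}
    (hx : x ∈ Ico (0 : ℝ) 1) : Summable fun n : ℕ => x ^ n / (2 * moment ω (2 * n + 1)) := by
  set r := Real.sqrt ((1 + x) / 2) with hrdef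
  have hr2 : r ^ 2 = (1 + x) / 2 := Real.sq_sqrt (by linarith [hx.1])
  have hr0 : 0 < r := Real.sqrt_pos.2 (by linarith [hx.1])
  have hr1 : r < 1 := by
    rw [hrdef, Real.sqrt_lt' one_pos]; linarith [hx.2]
  have hr : r ∈ Ico (0 : ℝ) 1 := ⟨hr0.le, hr1⟩
  have ht := hω.tail_pos r hr
  have hxr : x / r ^ 2 < 1 := by
    rw [hr2, div_lt_one (by linarith [hx.1])]; linarith [hx.2]
  have hxr0 : 0 ≤ x / r ^ 2 := div_nonneg hx.1 (by positivity)
  refine Summable.of_nonneg_of_le (fun n => ?_) (fun n => ?_)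
    ((summable_geometric_of_lt_one hxr0 hxr).mul_right (1 / (2 * (r * tail ω r))))
  · exact div_nonneg (pow_nonneg hx.1 _) (by linarith [hω.moment_pos (2 * n + 1)])
  · have h := hω.moment_ge (2 * n + 1) hr
    calc x ^ n / (2 * moment ω (2 * n + 1))
        ≤ x ^ n / (2 * (r ^ (2 * n + 1) * tail ω r)) := by
          have := hx.1
          gcongr
      _ = (x / r ^ 2) ^ n * (1 / (2 * (r * tail ω r))) := by
          rw [div_pow, pow_succ, pow_mul]; field_simp

theorem norm_kernel_term {ω : ℝ → ℝ} (hω : IsRadialWeight ω) (z ζ : ℂ) (n : ℕ) :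
    ‖(conj z * ζ) ^ n / ((2 * moment ω (2 * n + 1) : ℝ) : ℂ)‖
      = (‖z‖ * ‖ζ‖) ^ n / (2 * moment ω (2 * n + 1)) := by
  rw [norm_div, norm_pow, norm_mul, RCLike.norm_conj, Complex.norm_real, Real.norm_eq_abs,
    abs_of_pos (by linarith [hω.moment_pos (2 * n + 1)])]

theorem norm_kernel_term_le {ω : ℝ → ℝ} (hω : IsRadialWeight ω) (z ζ : ℂ) (hζ : ‖ζ‖ ≤ 1)
    (n : ℕ) : ‖(conj z * ζ) ^ n / ((2 * moment ω (2 * n + 1) : ℝ) : ℂ)‖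
      ≤ ‖z‖ ^ n / (2 * moment ω (2 * n + 1)) := by
  rw [norm_kernel_term hω]
  have := hω.moment_pos (2 * n + 1)
  gcongr
  exact mul_le_of_le_one_right (norm_nonneg _) hζ

theorem memBergman_bergmanKernel {ω : ℝ → ℝ} (hω : IsRadialWeight ω) {z : ℂ}
    (hz : z ∈ ball (0 : ℂ) 1) : MemBergman ω (bergmanKernel ω z) := by
  have hz' : ‖z‖ ∈ Ico (0 : ℝ) 1 := ⟨norm_nonneg _, by simpa using hz⟩
  have hs := hω.summable_kernel hz'
  have hd : DifferentiableOn ℂ (bergmanKernel ω z) (ball 0 1) := by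
    refine Complex.differentiableOn_tsum_of_summable_norm (F := fun n ζ =>
      (conj z * ζ) ^ n / ((2 * moment ω (2 * n + 1) : ℝ) : ℂ)) hs (fun n => ?_) isOpen_ball ?_
    · exact Differentiable.differentiableOn (by fun_prop)
    · intro n w hw
      exact norm_kernel_term_le hω z w (by simpa using (mem_ball_zero_iff.1 hw).le) n
  refine ⟨hd, integrable_discArea_iff.2 ?_⟩
  refine hω.integrable_norm.bdd_mul
    (c := (∑' n : ℕ, ‖z‖ ^ n / (2 * moment ω (2 * n + 1))) ^ 2) ?_ ?_
  · exact (hd.continuousOn.norm.pow 2).aestronglyMeasurable measurableSet_ball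
  · filter_upwards [ae_restrict_mem measurableSet_ball] with w hw
    rw [norm_pow, norm_norm]
    gcongr
    refine tsum_of_norm_bounded hs.hasSum fun n => ?_
    exact norm_kernel_term_le hω z w (by simpa using (mem_ball_zero_iff.1 hw).le) n

theorem MemBergman.integrable_mul {ω : ℝ → ℝ} (hω : IsRadialWeight ω) {f : ℂ → ℂ}
    (hf : MemBergman ω f) : IntegrableOn (fun z => f z * (ω ‖z‖ : ℂ)) (ball 0 1) := by
  have h1 := integrable_discArea_iff.1 hf.2
  refine Integrable.mono' (h1.add hω.integrable_norm) ?_ ?_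
  · exact (hf.1.continuousOn.aestronglyMeasurable measurableSet_ball).mul
      (Complex.continuous_ofReal.comp_aestronglyMeasurable
        hω.integrable_norm.aestronglyMeasurable)
  · filter_upwards [ae_restrict_mem measurableSet_ball] with w hw
    have h0 := hω.nonneg ‖w‖ ⟨norm_nonneg _, by simpa using hw⟩
    rw [norm_mul, Complex.norm_real, Real.norm_eq_abs, abs_of_nonneg h0]
    simp only [Pi.add_apply]
    nlinarith [mul_nonneg h0 (sq_nonneg (‖f w‖ - 1)), mul_nonneg h0 (sq_nonneg (‖f w‖))]

theorem integral_discArea_polar {g : ℂ → ℂ} (hg : IntegrableOn g (ball 0 1)) :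
    ∫ ζ, g ζ ∂discArea = ((1 / π : ℝ) : ℂ) *
      ∫ r in Ioo (0 : ℝ) 1, ∫ θ in (0 : ℝ)..(2 * π), (r : ℂ) * g (circleMap 0 r θ) := by
  have hsymm : ∀ p : ℝ × ℝ, Complex.polarCoord.symm p = circleMap 0 p.1 p.2 := by
    intro p
    rw [Complex.polarCoord_symm_apply, circleMap_zero, Complex.exp_mul_I, Complex.ofReal_cos,
      Complex.ofReal_sin]
  set G : ℂ → ℂ := (ball (0 : ℂ) 1).indicator g with hG
  have hGi : Integrable G := (integrable_indicator_iff measurableSet_ball).2 hg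
  have hpol : IntegrableOn (fun p : ℝ × ℝ => p.1 • G (Complex.polarCoord.symm p))
      polarCoord.target := by
    have h1 : Integrable (G ∘ Complex.measurableEquivRealProd.symm) :=
      (Complex.volume_preserving_equiv_real_prod.symm.integrable_comp_emb
        Complex.measurableEquivRealProd.symm.measurableEmbedding).2 hGi
    have h2 := (integrableOn_image_iff_integrableOn_abs_det_fderiv_smul volume
      (s := polarCoord.target) (f := polarCoord.symm) (f' := fderivPolarCoordSymm)
      polarCoord.open_target.measurableSet
      (fun p _ => (hasFDerivAt_polarCoord_symm p).hasFDerivWithinAt) polarCoord.symm.injOn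
      (G ∘ Complex.measurableEquivRealProd.symm)).1 h1.integrableOn
    refine h2.congr_fun (fun p hp => ?_) polarCoord.open_target.measurableSet
    have hp1 : 0 < p.1 := hp.1
    simp only [det_fderivPolarCoordSymm, abs_of_pos hp1, Function.comp_apply,
      Complex.measurableEquivRealProd_symm_polarCoord_symm_apply]
  have hint : ∫ ζ in ball (0 : ℂ) 1, g ζ
      = ∫ r in Ioi (0 : ℝ), ∫ θ in Ioo (-π) π, (r : ℂ) * G (circleMap 0 r θ) := by
    rw [← integral_indicator measurableSet_ball, ← Complex.integral_comp_polarCoord_symm]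
    rw [polarCoord_target, Measure.volume_eq_prod] at hpol ⊢
    rw [setIntegral_prod _ hpol]
    simp only [hsymm, Complex.real_smul, hG]
  have hcirc : ∀ r ∈ Ioi (0 : ℝ), ∫ θ in Ioo (-π) π, (r : ℂ) * G (circleMap 0 r θ)
      = (Iio (1 : ℝ)).indicator
        (fun r => ∫ θ in (0 : ℝ)..(2 * π), (r : ℂ) * g (circleMap 0 r θ)) r := by
    intro r hr
    have hmem : ∀ θ, circleMap 0 r θ ∈ ball (0 : ℂ) 1 ↔ r < 1 := by
      intro θ
      rw [mem_ball_zero_iff, norm_circleMap_zero, abs_of_pos hr]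
    by_cases h1 : r < 1
    · rw [indicator_of_mem (show r ∈ Iio (1 : ℝ) from h1)]
      have hper : Function.Periodic (fun θ => (r : ℂ) * g (circleMap 0 r θ)) (2 * π) := by
        intro θ
        simp only [periodic_circleMap 0 r θ]
      have := hper.intervalIntegral_add_eq (-π) 0
      rw [zero_add, show -π + 2 * π = π by ring,
        intervalIntegral.integral_of_le (by linarith [Real.pi_pos]),
        integral_Ioc_eq_integral_Ioo] at this
      rw [← this]
      congr 1; ext θ
      rw [hG, indicator_of_mem ((hmem θ).2 h1)]
    · rw [indicator_of_notMem (show r ∉ Iio (1 : ℝ) from h1)]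
      have : ∀ θ, G (circleMap 0 r θ) = 0 := fun θ =>
        indicator_of_notMem (fun h => h1 ((hmem θ).1 h)) _
      simp [this]
  unfold discArea
  rw [integral_smul_measure, ENNReal.toReal_ofReal (by positivity), hint,
    setIntegral_congr_fun measurableSet_Ioi hcirc, setIntegral_indicator measurableSet_Iio,
    Ioi_inter_Iio, Complex.real_smul]

theorem integral_circle_coeff {f : ℂ → ℂ} (hf : DifferentiableOn ℂ f (ball 0 1)) {r : ℝ}
    (hr : r ∈ Ioo (0 : ℝ) 1) (n : ℕ) :
    ∫ θ in (0 : ℝ)..(2 * π), f (circleMap 0 r θ) * conj (circleMap 0 r θ) ^ n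
      = 2 * π * (r : ℂ) ^ (2 * n) * ((n.factorial : ℂ)⁻¹ * iteratedDeriv n f 0) := by
  have h := DifferentiableOn.circleIntegral_one_div_sub_center_pow_smul hr.1 n
    (hf.mono (closedBall_subset_ball hr.2))
  unfold circleIntegral at h
  have key : ∀ θ : ℝ, deriv (circleMap 0 r) θ •
        (1 / (circleMap 0 r θ - 0) ^ (n + 1)) • f (circleMap 0 r θ)
      = (Complex.I / (r : ℂ) ^ (2 * n)) *
        (f (circleMap 0 r θ) * conj (circleMap 0 r θ) ^ n) := by
    intro θ
    have hr0 : (r : ℂ) ≠ 0 := Complex.ofReal_ne_zero.2 hr.1.ne'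
    have hc0 : circleMap 0 r θ ≠ 0 := circleMap_ne_center hr.1.ne'
    have hcc : circleMap 0 r θ * conj (circleMap 0 r θ) = (r : ℂ) ^ 2 := by
      rw [Complex.mul_conj, Complex.normSq_eq_norm_sq, norm_circleMap_zero, sq_abs]
      push_cast; rfl
    have hconj : conj (circleMap 0 r θ) = (r : ℂ) ^ 2 / circleMap 0 r θ := by
      rw [← hcc]; field_simp
    rw [deriv_circleMap, hconj, div_pow, ← pow_mul, sub_zero]
    simp only [smul_eq_mul]
    field_simp
    ring
  simp_rw [key] at h
  rw [intervalIntegral.integral_const_mul] at h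
  have hr0 : (r : ℂ) ≠ 0 := Complex.ofReal_ne_zero.2 hr.1.ne'
  have hn : (n.factorial : ℂ) ≠ 0 := Nat.cast_ne_zero.2 n.factorial_ne_zero
  have hI := Complex.I_ne_zero
  rw [smul_eq_mul] at h
  field_simp at h ⊢
  linear_combination h

theorem integral_mul_conj_pow {ω : ℝ → ℝ} (hω : IsRadialWeight ω) {f : ℂ → ℂ}
    (hf : MemBergman ω f) (n : ℕ) :
    ∫ ζ, f ζ * conj ζ ^ n * (ω ‖ζ‖ : ℂ) ∂discArea
      = ((2 * moment ω (2 * n + 1) : ℝ) : ℂ) * ((n.factorial : ℂ)⁻¹ * iteratedDeriv n f 0) := by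
  have hi : IntegrableOn (fun ζ : ℂ => f ζ * conj ζ ^ n * (ω ‖ζ‖ : ℂ)) (ball 0 1) := by
    have := (hf.integrable_mul hω).bdd_mul (c := 1) (f := fun ζ : ℂ => conj ζ ^ n)
      (by fun_prop) (by
        filter_upwards [ae_restrict_mem measurableSet_ball] with w hw
        rw [norm_pow, RCLike.norm_conj]
        exact pow_le_one₀ (norm_nonneg _) (mem_ball_zero_iff.1 hw).le)
    refine this.congr (Eventually.of_forall fun ζ => ?_)
    simp only; ring
  rw [integral_discArea_polar hi]
  have h1 : ∀ r ∈ Ioo (0 : ℝ) 1, ∫ θ in (0 : ℝ)..(2 * π), (r : ℂ) *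
        (f (circleMap 0 r θ) * conj (circleMap 0 r θ) ^ n * (ω ‖circleMap 0 r θ‖ : ℂ))
      = (2 * π * ((n.factorial : ℂ)⁻¹ * iteratedDeriv n f 0)) *
        ((r ^ (2 * n + 1) * ω r : ℝ) : ℂ) := by
    intro r hr
    have : ∀ θ : ℝ, (r : ℂ) *
        (f (circleMap 0 r θ) * conj (circleMap 0 r θ) ^ n * (ω ‖circleMap 0 r θ‖ : ℂ))
        = ((r : ℂ) * (ω r : ℂ)) * (f (circleMap 0 r θ) * conj (circleMap 0 r θ) ^ n) := by
      intro θ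
      rw [norm_circleMap_zero, abs_of_pos hr.1]; ring
    simp_rw [this]
    rw [intervalIntegral.integral_const_mul, integral_circle_coeff hf.1 hr]
    push_cast; ring
  rw [setIntegral_congr_fun measurableSet_Ioo h1, integral_const_mul, integral_complex_ofReal,
    moment, intervalIntegral.integral_of_le zero_le_one, integral_Ioc_eq_integral_Ioo]
  have hpi : (π : ℂ) ≠ 0 := Complex.ofReal_ne_zero.2 Real.pi_ne_zero
  push_cast
  field_simp

/-- The kernel defined by the series reproduces `A²_ω`. -/
theorem isReproducingKernelAt_bergmanKernel {ω : ℝ → ℝ} (hω : IsRadialWeight ω) {z : ℂ}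
    (hz : z ∈ ball (0 : ℂ) 1) : IsReproducingKernelAt ω z (bergmanKernel ω z) := by
  refine ⟨memBergman_bergmanKernel hω hz, fun f hf => ?_⟩
  have hs := hω.summable_kernel (x := ‖z‖) ⟨norm_nonneg _, by simpa using hz⟩
  have hae : ∀ᵐ ζ ∂discArea, ζ ∈ ball (0 : ℂ) 1 :=
    Measure.ae_smul_measure (ae_restrict_mem measurableSet_ball) _
  set T : ℕ → ℂ → ℂ := fun n ζ => (conj z * ζ) ^ n / ((2 * moment ω (2 * n + 1) : ℝ) : ℂ)
  set F : ℕ → ℂ → ℂ := fun n ζ => conj (T n ζ) * (f ζ * (ω ‖ζ‖ : ℂ)) with hF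
  have hfi := integrable_discArea_iff.2 (hf.integrable_mul hω)
  have hT : ∀ n, ∀ᵐ ζ ∂discArea, ‖conj (T n ζ)‖ ≤ ‖z‖ ^ n / (2 * moment ω (2 * n + 1)) := by
    intro n
    filter_upwards [hae] with ζ hζ
    rw [RCLike.norm_conj]
    exact norm_kernel_term_le hω z ζ (mem_ball_zero_iff.1 hζ).le n
  have hFi : ∀ n, Integrable (F n) discArea := fun n =>
    hfi.bdd_mul (by fun_prop) (hT n)
  have hFs : Summable fun n => ∫ ζ, ‖F n ζ‖ ∂discArea := by
    refine Summable.of_nonneg_of_le (fun n => integral_nonneg fun _ => norm_nonneg _)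
      (fun n => ?_) (hs.mul_right (∫ ζ, ‖f ζ * (ω ‖ζ‖ : ℂ)‖ ∂discArea))
    rw [← integral_const_mul]
    refine integral_mono_ae (hFi n).norm (hfi.norm.const_mul _) ?_
    filter_upwards [hT n] with ζ hζ
    rw [hF]
    simp only [norm_mul] at hζ ⊢
    gcongr
  have hsum := hasSum_integral_of_summable_integral_norm hFi hFs
  have hterm : ∀ n, ∫ ζ, F n ζ ∂discArea
      = (n.factorial : ℂ)⁻¹ • (z - 0) ^ n • iteratedDeriv n f 0 := by
    intro n
    have hm : ((2 * moment ω (2 * n + 1) : ℝ) : ℂ) ≠ 0 :=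
      Complex.ofReal_ne_zero.2 (by linarith [hω.moment_pos (2 * n + 1)])
    have : ∀ ζ, F n ζ = (z ^ n / ((2 * moment ω (2 * n + 1) : ℝ) : ℂ)) *
        (f ζ * conj ζ ^ n * (ω ‖ζ‖ : ℂ)) := by
      intro ζ
      simp only [hF, T, map_div₀, map_pow, map_mul, Complex.conj_conj, Complex.conj_ofReal]
      ring
    simp_rw [this]
    rw [integral_const_mul, integral_mul_conj_pow hω hf, sub_zero, smul_eq_mul, smul_eq_mul]
    field_simp
  simp_rw [hterm] at hsum
  rw [(Complex.hasSum_taylorSeries_on_ball hf.1 hz).unique hsum]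
  congr 1; ext ζ
  rw [bergmanKernel, Complex.conj_tsum, tsum_mul_right]
  ring

/-- Reproducing kernels of `A²_ω` are unique. -/
theorem IsReproducingKernelAt.eqOn_bergmanKernel {ω : ℝ → ℝ} (hω : IsRadialWeight ω) {z : ℂ}
    {k : ℂ → ℂ} (hk : IsReproducingKernelAt ω z k) :
    EqOn k (bergmanKernel ω z) (ball 0 1) := by
  intro w hw
  have h1 := (isReproducingKernelAt_bergmanKernel hω hw).2 k hk.1
  have h2 := hk.2 _ (memBergman_bergmanKernel hω hw)
  have h3 : k w = conj (bergmanKernel ω w z) := by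
    rw [h1, h2, ← integral_conj]
    congr 1; ext ζ
    simp only [map_mul, Complex.conj_conj, Complex.conj_ofReal]
    ring
  rw [h3, bergmanKernel, bergmanKernel, Complex.conj_tsum]
  congr 1; ext n
  simp only [map_div₀, map_pow, map_mul, Complex.conj_conj, Complex.conj_ofReal]
  ring

/-- The Bergman projection `P_ω`. -/
noncomputable def bergmanProjection (ω : ℝ → ℝ) (f : ℂ → ℂ) (z : ℂ) : ℂ :=
  ∫ ζ, f ζ * conj (bergmanKernel ω z ζ) * (ω ‖ζ‖ : ℂ) ∂discArea

/-- The norm `ess sup_{z ∈ 𝔻} |f(z)| v(|z|)`, for `v ≥ 0` on `[0,1)`. -/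
noncomputable def growthNorm (v : ℝ → ℝ) (f : ℂ → ℂ) : ℝ≥0∞ :=
  eLpNorm (fun z => f z * (v ‖z‖ : ℂ)) ∞ discArea

/-- Membership in the growth space `L^∞_v`. -/
def MemGrowth (v : ℝ → ℝ) (f : ℂ → ℂ) : Prop :=
  AEStronglyMeasurable f discArea ∧ growthNorm v f < ∞

/-- Membership in `H^∞_v`, the space of analytic functions in `L^∞_v`. -/
def MemAnalyticGrowth (v : ℝ → ℝ) (f : ℂ → ℂ) : Prop :=
  MemGrowth v f ∧ DifferentiableOn ℂ f (ball 0 1)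

/-- `P_ω : L^∞_v → H^∞_v` is bounded: for `f ∈ L^∞_v` the integral defining `P_ω f` converges
absolutely at every point of the disc, `P_ω f` belongs to `H^∞_v`, and its norm is at most a
constant times that of `f`. -/
def BergmanProjectionBounded (ω v : ℝ → ℝ) : Prop :=
  ∃ C : ℝ≥0, ∀ f : ℂ → ℂ, MemGrowth v f →
    (∀ z ∈ ball (0 : ℂ) 1,
      Integrable (fun ζ => f ζ * conj (bergmanKernel ω z ζ) * (ω ‖ζ‖ : ℂ)) discArea) ∧
    MemAnalyticGrowth v (bergmanProjection ω f) ∧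
    growthNorm v (bergmanProjection ω f) ≤ C * growthNorm v f

/-! Apart from the integrability of `ω / ν̂`, which comes from testing on `1 / ν̂`, everything
follows from one test function, `f(ζ) = arg(-ζ) / ν̂(ζ)`. On circles its angular part is `θ - π`,
bounded, with Fourier coefficients `i / n`. With `T_n = ∫ s^{n+1} ω / ν̂` (`tailMoment`), the Taylor
coefficients of `P_ω f` are `i T_n / (n ω_{2n+1})`: all lie on one ray, so nothing cancels at `z =
r`, and boundedness gives (`BergmanProjectionBounded.exists_sum_le`) `ν̂(r) ∑ (rⁿ / n) T_n /
ω_{2n+1} ≤ C` for all `r` in `[0,1)`. The weight `1 / n` gives each dyadic block of frequencies a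
total mass of order one. Write `r_k = 1 - 2⁻ᵏ`; powers of `r_k` with exponent of order `2ᵏ` are
bounded below for `k ≥ 1`.

Upper doubling passes between the weights through a single block, `ν̂(r) r^{3N} T_{3N} ≤ 3C
ω_{4N+1}`. If `ω` is upper doubling, the moment is at most a multiple of `ω̂(r_{k+1})` and `T_{3N}`
is at least a multiple of `ω̂(r_{k+1}) / ν̂(r_{k+1})`, so `ν̂(r_k) ≲ ν̂(r_{k+1})`. If `ν` is upper
doubling, the same bound shows that the part of `ω_{4N+1}` coming from `(0, r_k)` is at most half of
it; hence `ω_{4N+1} ≤ 2 ω̂(r_k)`, which forces upper doubling of `ω`.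

Lower doubling uses all the blocks up to `r_K`. Bounding `T_n` below by a tail quotient at `r_K`, or
at `r_{k+1}` in the `k`-th block, yields `a_K ∑_{k<K} 1 / a_{k+1} ≤ C` for `a_k = ω̂(r_k)`,
respectively `a_k = ν̂(r_k)`; such a sequence decays geometrically
(`exists_two_mul_le_of_sum_inv_le`). -/

/-! ### Dyadic points and their powers -/

/-- The dyadic point `1 - 2⁻ᵏ` of `[0,1)`. -/
noncomputable def dyadicPoint (k : ℕ) : ℝ := 1 - (1 / 2) ^ k

theorem dyadicPoint_zero : dyadicPoint 0 = 0 := by simp [dyadicPoint]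

theorem dyadicPoint_mem (k : ℕ) : dyadicPoint k ∈ Ico (0 : ℝ) 1 := by
  have h1 : (1 / 2 : ℝ) ^ k ≤ 1 := pow_le_one₀ (by norm_num) (by norm_num)
  have h2 : (0 : ℝ) < (1 / 2) ^ k := by positivity
  constructor <;> unfold dyadicPoint <;> linarith

theorem dyadicPoint_mono : Monotone dyadicPoint := by
  intro i j h
  have := pow_le_pow_of_le_one (by norm_num : (0 : ℝ) ≤ 1 / 2) (by norm_num) h
  unfold dyadicPoint
  linarith

theorem dyadicPoint_succ (k : ℕ) : dyadicPoint (k + 1) = (1 + dyadicPoint k) / 2 := by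
  unfold dyadicPoint
  ring

theorem tendsto_dyadicPoint : Tendsto dyadicPoint atTop (𝓝[<] 1) := by
  refine tendsto_nhdsWithin_iff.2 ⟨?_, Eventually.of_forall fun k => (dyadicPoint_mem k).2⟩
  have := (tendsto_pow_atTop_nhds_zero_of_lt_one (by norm_num : (0 : ℝ) ≤ 1 / 2)
    (by norm_num)).const_sub 1
  rwa [sub_zero] at this

/-- Every point of `[0,1)` lies between two consecutive dyadic points. -/
theorem exists_dyadicPoint_near {r : ℝ} (hr : r ∈ Ico (0 : ℝ) 1) :
    ∃ k, dyadicPoint k ≤ r ∧ r ≤ dyadicPoint (k + 1) := by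
  obtain ⟨n, h1, h2⟩ := exists_nat_pow_near_of_lt_one (x := 1 - r) (y := 1 / 2)
    (by linarith [hr.2]) (by linarith [hr.1]) (by norm_num) (by norm_num)
  refine ⟨n, ?_, ?_⟩ <;> unfold dyadicPoint <;> linarith

theorem dyadicPoint_pow_le (k L : ℕ) : dyadicPoint k ^ (L * 2 ^ k) ≤ (1 / 2) ^ L := by
  rw [mul_comm, pow_mul]
  have h0 := (dyadicPoint_mem k).1
  refine pow_le_pow_left₀ (pow_nonneg h0 _) ?_ L
  have h1 : dyadicPoint k ≤ Real.exp (-(1 / 2) ^ k) := by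
    have := Real.one_sub_le_exp_neg ((1 / 2 : ℝ) ^ k)
    simpa [dyadicPoint] using this
  calc dyadicPoint k ^ 2 ^ k ≤ Real.exp (-(1 / 2) ^ k) ^ 2 ^ k := pow_le_pow_left₀ h0 h1 _
    _ = Real.exp (-1) := by
      rw [← Real.exp_nat_mul]
      congr 1
      push_cast
      rw [mul_neg, ← mul_pow]
      norm_num
    _ ≤ 1 / 2 := by
      rw [Real.exp_neg, one_div]
      exact inv_anti₀ (by norm_num) (by linarith [Real.add_one_le_exp (1 : ℝ)])

/-- The case `k = 0` is excluded because `dyadicPoint 0 = 0`. -/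
theorem dyadicPoint_pow_ge {k : ℕ} (hk : 1 ≤ k) {L n : ℕ} (hn : n ≤ L * 2 ^ k) :
    (1 / 4 : ℝ) ^ L ≤ dyadicPoint k ^ n := by
  have h0 := dyadicPoint_mem k
  refine le_trans ?_ (pow_le_pow_of_le_one h0.1 h0.2.le hn)
  rw [mul_comm, pow_mul]
  refine pow_le_pow_left₀ (by norm_num) ?_ L
  obtain ⟨j, rfl⟩ := Nat.exists_eq_add_of_le' hk
  -- Bernoulli's inequality at the full exponent `2 ^ (j + 1)` would only give `0`; at half of it,
  -- it gives `1 / 2`, which is then squared.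
  have h1 : (1 / 2 : ℝ) ≤ dyadicPoint (j + 1) ^ 2 ^ j := by
    have := one_add_mul_le_pow (a := -(1 / 2 : ℝ) ^ (j + 1))
      (by have := pow_le_one₀ (n := j + 1) (by norm_num : (0 : ℝ) ≤ 1 / 2) (by norm_num)
          linarith) (2 ^ j)
    have h2 : ((2 ^ j : ℕ) : ℝ) * -(1 / 2 : ℝ) ^ (j + 1) = -(1 / 2) := by
      push_cast
      rw [pow_succ, mul_neg, ← mul_assoc, ← mul_pow]
      norm_num
    rw [h2] at this
    unfold dyadicPoint
    rw [sub_eq_add_neg]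
    linarith
  calc (1 / 4 : ℝ) = (1 / 2) ^ 2 := by norm_num
    _ ≤ (dyadicPoint (j + 1) ^ 2 ^ j) ^ 2 := by gcongr
    _ = _ := by rw [← pow_mul, pow_succ 2 j]

/-! ### Tails and moments of a radial weight -/

theorem tail_eq_setIntegral (ω : ℝ → ℝ) {r : ℝ} (hr : r ≤ 1) :
    tail ω r = ∫ s in Ioo r 1, ω s := by
  rw [tail, intervalIntegral.integral_of_le hr, integral_Ioc_eq_integral_Ioo]

theorem moment_eq_setIntegral (ω : ℝ → ℝ) (n : ℕ) :
    moment ω n = ∫ s in Ioo (0 : ℝ) 1, s ^ n * ω s := by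
  rw [moment, intervalIntegral.integral_of_le zero_le_one, integral_Ioc_eq_integral_Ioo]

theorem integrableOn_pow_mul {ω : ℝ → ℝ} (hω : IntegrableOn ω (Ioo (0 : ℝ) 1)) (n : ℕ) :
    IntegrableOn (fun s => s ^ n * ω s) (Ioo (0 : ℝ) 1) := by
  refine hω.bdd_mul (c := 1) (by fun_prop) ?_
  filter_upwards [ae_restrict_mem measurableSet_Ioo] with y hy
  rw [norm_pow, Real.norm_eq_abs, abs_of_pos hy.1]
  exact pow_le_one₀ hy.1.le hy.2.le

theorem setIntegral_Ioo_split {f : ℝ → ℝ} (hf : IntegrableOn f (Ioo (0 : ℝ) 1)) {r : ℝ}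
    (hr : r ∈ Ico (0 : ℝ) 1) :
    ∫ s in Ioo (0 : ℝ) 1, f s = (∫ s in Ioo 0 r, f s) + ∫ s in Ioo r 1, f s := by
  have h : ∀ a b : ℝ, a ≤ b → ∫ s in Ioo a b, f s = ∫ s in a..b, f s := fun a b hab => by
    rw [intervalIntegral.integral_of_le hab, integral_Ioc_eq_integral_Ioo]
  have hi : ∀ a b : ℝ, 0 ≤ a → a ≤ b → b ≤ 1 → IntervalIntegrable f volume a b :=
    fun a b ha hab hb => by
      rw [intervalIntegrable_iff_integrableOn_Ioo_of_le hab]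
      exact hf.mono_set (Ioo_subset_Ioo ha hb)
  rw [h _ _ zero_le_one, h _ _ hr.1, h _ _ hr.2.le,
    intervalIntegral.integral_add_adjacent_intervals (hi _ _ le_rfl hr.1 hr.2.le)
      (hi _ _ hr.1 hr.2.le le_rfl)]

namespace IsRadialWeight

variable {ω ν : ℝ → ℝ}

theorem integrableOn_Ioo (hω : IsRadialWeight ω) : IntegrableOn ω (Ioo (0 : ℝ) 1) :=
  hω.integrable.mono_set Ioo_subset_Ico_self

theorem antitoneOn_tail (hω : IsRadialWeight ω) : AntitoneOn (tail ω) (Ico (0 : ℝ) 1) := by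
  intro r hr t ht h
  rw [tail_eq_setIntegral ω hr.2.le, tail_eq_setIntegral ω ht.2.le]
  refine setIntegral_mono_set (hω.integrableOn_Ioo.mono_set (Ioo_subset_Ioo_left hr.1)) ?_
    (Ioo_subset_Ioo_left h).eventuallyLE
  filter_upwards [ae_restrict_mem measurableSet_Ioo] with s hs
  exact hω.nonneg s ⟨hr.1.trans hs.1.le, hs.2⟩

theorem continuousOn_tail (hω : IsRadialWeight ω) : ContinuousOn (tail ω) (Ico (0 : ℝ) 1) := by
  have h : IntegrableOn ω (uIcc 0 1) := by
    rw [uIcc_of_le zero_le_one, integrableOn_Icc_iff_integrableOn_Ioo]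
    exact hω.integrableOn_Ioo
  have := intervalIntegral.continuousOn_primitive_interval_left h
  rw [uIcc_of_le zero_le_one] at this
  exact this.mono Ico_subset_Icc_self

theorem tail_dyadicPoint_pos (hω : IsRadialWeight ω) (k : ℕ) : 0 < tail ω (dyadicPoint k) :=
  hω.tail_pos _ (dyadicPoint_mem k)

theorem tail_dyadicPoint_anti (hω : IsRadialWeight ω) :
    Antitone fun k => tail ω (dyadicPoint k) := fun _ _ h =>
  hω.antitoneOn_tail (dyadicPoint_mem _) (dyadicPoint_mem _) (dyadicPoint_mono h)

theorem moment_anti (hω : IsRadialWeight ω) : Antitone (moment ω) := by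
  intro m n h
  rw [moment_eq_setIntegral, moment_eq_setIntegral]
  refine setIntegral_mono_on (integrableOn_pow_mul hω.integrableOn_Ioo _)
    (integrableOn_pow_mul hω.integrableOn_Ioo _) measurableSet_Ioo fun s hs => ?_
  exact mul_le_mul_of_nonneg_right (pow_le_pow_of_le_one hs.1.le hs.2.le h)
    (hω.nonneg s ⟨hs.1.le, hs.2⟩)

theorem setIntegral_pow_mul_le_tail (hω : IsRadialWeight ω) (n : ℕ) {r : ℝ}
    (hr : r ∈ Ico (0 : ℝ) 1) : ∫ s in Ioo r 1, s ^ n * ω s ≤ tail ω r := by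
  rw [tail_eq_setIntegral ω hr.2.le]
  refine setIntegral_mono_on ((integrableOn_pow_mul hω.integrableOn_Ioo n).mono_set
    (Ioo_subset_Ioo_left hr.1)) (hω.integrableOn_Ioo.mono_set (Ioo_subset_Ioo_left hr.1))
    measurableSet_Ioo fun s hs => ?_
  have h0 : 0 ≤ s := hr.1.trans hs.1.le
  exact mul_le_of_le_one_left (hω.nonneg s ⟨h0, hs.2⟩) (pow_le_one₀ h0 hs.2.le)

theorem moment_le_add_tail (hω : IsRadialWeight ω) (n : ℕ) {r : ℝ} (hr : r ∈ Ico (0 : ℝ) 1) :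
    moment ω n ≤ (∫ s in Ioo 0 r, s ^ n * ω s) + tail ω r := by
  rw [moment_eq_setIntegral, setIntegral_Ioo_split (integrableOn_pow_mul hω.integrableOn_Ioo n) hr]
  linarith [hω.setIntegral_pow_mul_le_tail n hr]

end IsRadialWeight

/-! ### Doubling conditions along dyadic points -/

/-- If consecutive terms of a positive sequence have eventually bounded ratio, they have bounded
ratio. -/
theorem exists_forall_le_mul_succ {a : ℕ → ℝ} (ha : ∀ k, 0 < a k) {D : ℝ} {k₀ : ℕ}
    (h : ∀ k ≥ k₀, a k ≤ D * a (k + 1)) : ∃ D' : ℝ, 1 ≤ D' ∧ ∀ k, a k ≤ D' * a (k + 1) := by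
  have hpos : ∀ k, 0 ≤ a k / a (k + 1) := fun k => (div_pos (ha k) (ha _)).le
  have hs : 0 ≤ ∑ i ∈ Finset.range k₀, a i / a (i + 1) := Finset.sum_nonneg fun i _ => hpos i
  refine ⟨max D 1 + ∑ i ∈ Finset.range k₀, a i / a (i + 1), by linarith [le_max_right D 1],
    fun k => ?_⟩
  rw [← div_le_iff₀ (ha _)]
  by_cases hk : k < k₀
  · have := Finset.single_le_sum (f := fun i => a i / a (i + 1)) (fun i _ => hpos i)
      (Finset.mem_range.2 hk)
    have h1 := le_max_right D 1
    linarith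
  · have := (div_le_iff₀ (ha (k + 1))).2 (h k (not_lt.1 hk))
    linarith [le_max_left D 1]

theorem UpperDoubling.exists_dyadic {ω : ℝ → ℝ} (hω : IsRadialWeight ω) (h : UpperDoubling ω) :
    ∃ D : ℝ, 1 ≤ D ∧ ∀ k, tail ω (dyadicPoint k) ≤ D * tail ω (dyadicPoint (k + 1)) := by
  obtain ⟨C, -, hC⟩ := h
  obtain ⟨k₀, hk₀⟩ := eventually_atTop.1 (tendsto_dyadicPoint.eventually hC)
  refine exists_forall_le_mul_succ hω.tail_dyadicPoint_pos (D := C) (k₀ := k₀) fun k hk => ?_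
  rw [dyadicPoint_succ]
  exact hk₀ k hk

theorem eventually_mem_Ico : ∀ᶠ r in 𝓝[<] (1 : ℝ), r ∈ Ico (0 : ℝ) 1 :=
  Filter.mem_of_superset (Ioo_mem_nhdsLT (zero_lt_one' ℝ)) Ioo_subset_Ico_self

theorem upperDoubling_of_dyadic {ω : ℝ → ℝ} (hω : IsRadialWeight ω) {D : ℝ} {k₀ : ℕ}
    (h : ∀ k ≥ k₀, tail ω (dyadicPoint k) ≤ D * tail ω (dyadicPoint (k + 1))) :
    UpperDoubling ω := by
  obtain ⟨D', hD', h'⟩ := exists_forall_le_mul_succ hω.tail_dyadicPoint_pos h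
  -- For `r` between the dyadic points of index `k` and `k + 1`, the midpoint `(1 + r) / 2` is at
  -- most the one of index `k + 2`: two dyadic steps, one factor `D'` each.
  refine ⟨D' * D', by positivity, ?_⟩
  filter_upwards [eventually_mem_Ico] with r hr
  obtain ⟨k, h1, h2⟩ := exists_dyadicPoint_near hr
  have hr' : (1 + r) / 2 ∈ Ico (0 : ℝ) 1 := ⟨by linarith [hr.1], by linarith [hr.2]⟩
  have h3 : (1 + r) / 2 ≤ dyadicPoint (k + 2) := by
    rw [dyadicPoint_succ]
    linarith
  calc tail ω r ≤ tail ω (dyadicPoint k) := hω.antitoneOn_tail (dyadicPoint_mem k) hr h1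
    _ ≤ D' * (D' * tail ω (dyadicPoint (k + 2))) :=
      (h' k).trans (mul_le_mul_of_nonneg_left (h' (k + 1)) (by linarith))
    _ ≤ D' * D' * tail ω ((1 + r) / 2) := by
      rw [mul_assoc]
      gcongr
      exact hω.antitoneOn_tail hr' (dyadicPoint_mem _) h3

theorem lowerDoubling_of_dyadic {ω : ℝ → ℝ} (hω : IsRadialWeight ω) {p : ℕ}
    (h : ∀ k, 2 * tail ω (dyadicPoint (k + p)) ≤ tail ω (dyadicPoint k)) :
    LowerDoubling ω := by
  -- The `p` steps start at the dyadic point above `r`; the extra factor `2` in `K` pays for the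
  -- rounding, since `1 - r` may be as large as `2⁻ᵏ`.
  refine ⟨2 ^ (p + 1), 2, one_lt_pow₀ one_lt_two p.succ_ne_zero, one_lt_two, ?_⟩
  filter_upwards [eventually_mem_Ico] with r hr
  obtain ⟨k, h1, h2⟩ := exists_dyadicPoint_near hr
  have hlo : dyadicPoint (k + 1 + p) ≤ 1 - (1 - r) / 2 ^ (p + 1) := by
    have : (1 - r) / 2 ^ (p + 1) ≤ (1 / 2) ^ k / 2 ^ (p + 1) := by
      unfold dyadicPoint at h1
      gcongr
      linarith
    have h3 : (1 / 2 : ℝ) ^ k / 2 ^ (p + 1) = (1 / 2) ^ (k + 1 + p) := by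
      simp only [one_div, inv_pow]
      field_simp
      ring
    unfold dyadicPoint
    linarith
  have hmem : 1 - (1 - r) / 2 ^ (p + 1) ∈ Ico (0 : ℝ) 1 := by
    refine ⟨(dyadicPoint_mem _).1.trans hlo, ?_⟩
    have : 0 < (1 - r) / 2 ^ (p + 1) := div_pos (by linarith [hr.2]) (by positivity)
    linarith
  have h4 := hω.antitoneOn_tail (dyadicPoint_mem _) hmem hlo
  have h5 := hω.antitoneOn_tail hr (dyadicPoint_mem _) h2
  linarith [h (k + 1)]

/-- A sequence that dominates the partial sums of reciprocals decays geometrically. -/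
theorem exists_two_mul_le_of_sum_inv_le {a : ℕ → ℝ} (ha : ∀ k, 0 < a k) (hanti : Antitone a)
    {C : ℝ} (h : ∀ K, 1 ≤ K → a K * ∑ k ∈ Finset.range K, 1 / a (k + 1) ≤ C) :
    ∃ p, ∀ k, 2 * a (k + p) ≤ a k := by
  obtain ⟨p, hp⟩ := exists_nat_ge (max 1 (2 * C))
  have hp1 : (1 : ℝ) ≤ p := (le_max_left _ _).trans hp
  have hp1' : 1 ≤ p := by exact_mod_cast hp1
  have hp2 : 2 * C ≤ p := (le_max_right _ _).trans hp
  refine ⟨p, fun k => ?_⟩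
  -- Only the last `p` terms are kept; each is at least `1 / a k` by monotonicity. The hypothesis at
  -- `k + p` then gives `a (k + p) * p ≤ C * a k`, and `p ≥ 2 * C`.
  have h1 : (p : ℝ) / a k ≤ ∑ i ∈ Finset.range (k + p), 1 / a (i + 1) := by
    rw [Finset.sum_range_add]
    have h2 : (0 : ℝ) ≤ ∑ i ∈ Finset.range k, 1 / a (i + 1) :=
      Finset.sum_nonneg fun i _ => (one_div_pos.2 (ha _)).le
    have h3 : ∑ _i ∈ Finset.range p, 1 / a k ≤ ∑ i ∈ Finset.range p, 1 / a (k + i + 1) :=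
      Finset.sum_le_sum fun i _ => one_div_le_one_div_of_le (ha _) (hanti (by omega))
    rw [Finset.sum_const, Finset.card_range, nsmul_eq_mul, mul_one_div] at h3
    linarith
  have h2 : a (k + p) * (p / a k) ≤ C :=
    (mul_le_mul_of_nonneg_left h1 (ha _).le).trans (h (k + p) (by omega))
  rw [← mul_div_assoc, div_le_iff₀ (ha k)] at h2
  have h3 : 2 * a (k + p) * p ≤ a k * p := by nlinarith [ha k]
  exact le_of_mul_le_mul_right h3 (by linarith)

/-- For weights in the upper doubling class the moments are controlled by the tails. -/
theorem exists_moment_le_tail {ω : ℝ → ℝ} (hω : IsRadialWeight ω) {D : ℝ} (hD : 1 ≤ D)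
    (h : ∀ k, tail ω (dyadicPoint k) ≤ D * tail ω (dyadicPoint (k + 1))) :
    ∃ (L : ℕ) (M : ℝ), 1 ≤ L ∧ 0 < M ∧
      ∀ k n, L * 2 ^ k ≤ n → moment ω n ≤ M * tail ω (dyadicPoint k) := by
  -- `L` is chosen so that the gain `2⁻ᴸ` of one dyadic step absorbs the constant `2 * D` of the
  -- induction below.
  obtain ⟨L₀, hL₀⟩ := exists_pow_lt_of_lt_one (show 0 < 1 / (2 * D) by positivity)
    (by norm_num : (1 / 2 : ℝ) < 1)
  set L := L₀ + 1
  have hL : (1 / 2 : ℝ) ^ L * (2 * D) ≤ 1 := by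
    rw [← le_div_iff₀ (by positivity)]
    exact (pow_le_pow_of_le_one (by norm_num) (by norm_num) (Nat.le_succ L₀)).trans hL₀.le
  have hint : ∀ n (r : ℝ), r ∈ Ico (0 : ℝ) 1 →
      IntegrableOn (fun s => s ^ n * ω s) (Ioo 0 r) := fun n r hr =>
    (integrableOn_pow_mul hω.integrableOn_Ioo n).mono_set (Ioo_subset_Ioo_right hr.2.le)
  -- Doubling the exponent gains `2⁻ᴸ` on the old interval, and the new piece costs at most one
  -- tail. The total is at most twice the old tail, hence `2 * D` times the new one.
  have key : ∀ k, ∫ s in Ioo 0 (dyadicPoint k), s ^ (L * 2 ^ k) * ω s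
      ≤ 2 * D * tail ω (dyadicPoint k) := by
    intro k
    induction k with
    | zero =>
      rw [dyadicPoint_zero, Ioo_self, Measure.restrict_empty, integral_zero_measure]
      have := hω.tail_pos 0 ⟨le_rfl, one_pos⟩
      positivity
    | succ k ih =>
      set r := dyadicPoint k
      set t := dyadicPoint (k + 1)
      have hr : r ∈ Ico (0 : ℝ) 1 := dyadicPoint_mem k
      have ht : t ∈ Ico (0 : ℝ) 1 := dyadicPoint_mem (k + 1)
      have hrt : r ≤ t := dyadicPoint_mono k.le_succ
      set m := L * 2 ^ (k + 1)
      have hm : m = L * 2 ^ k + L * 2 ^ k := by simp only [m]; ring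
      have hsplit : ∫ s in Ioo 0 t, s ^ m * ω s
          ≤ (∫ s in Ioo 0 r, s ^ m * ω s) + tail ω r := by
        have h1 := setIntegral_Ioo_split (integrableOn_pow_mul hω.integrableOn_Ioo m) hr
        have h2 := hω.setIntegral_pow_mul_le_tail m hr
        have h3 : ∫ s in Ioo 0 t, s ^ m * ω s ≤ ∫ s in Ioo 0 1, s ^ m * ω s := by
          refine setIntegral_mono_set (integrableOn_pow_mul hω.integrableOn_Ioo m) ?_
            (Ioo_subset_Ioo_right ht.2.le).eventuallyLE
          filter_upwards [ae_restrict_mem measurableSet_Ioo] with s hs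
          exact mul_nonneg (pow_nonneg hs.1.le _) (hω.nonneg s ⟨hs.1.le, hs.2⟩)
        linarith
      have hlow : ∫ s in Ioo 0 r, s ^ m * ω s
          ≤ (1 / 2) ^ L * ∫ s in Ioo 0 r, s ^ (L * 2 ^ k) * ω s := by
        rw [← integral_const_mul]
        refine setIntegral_mono_on (hint _ r hr) ((hint _ r hr).const_mul _) measurableSet_Ioo
          fun s hs => ?_
        rw [hm, pow_add, mul_assoc]
        have h0 := hs.1.le
        refine mul_le_mul_of_nonneg_right ?_
          (mul_nonneg (pow_nonneg h0 _) (hω.nonneg s ⟨h0, hs.2.trans hr.2⟩))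
        exact (pow_le_pow_left₀ h0 hs.2.le _).trans (dyadicPoint_pow_le k L)
      have hq : (0 : ℝ) < (1 / 2) ^ L := by positivity
      have h4 := mul_le_mul_of_nonneg_left ih hq.le
      have h5 : (1 / 2 : ℝ) ^ L * (2 * D * tail ω r) ≤ tail ω r := by
        rw [← mul_assoc]
        exact mul_le_of_le_one_left (hω.tail_pos r hr).le hL
      linarith [h k]
  refine ⟨L, 2 * D + 1, Nat.le_add_left _ _, by positivity, fun k n hn => ?_⟩
  have h1 := hω.moment_le_add_tail (L * 2 ^ k) (dyadicPoint_mem k)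
  linarith [hω.moment_anti hn, key k]

/-! ### Fourier coefficients of the angular part -/

/-- The sign moves the jump of the argument to the positive real axis, so that `θ - π` stays in the
principal range `(-π, π]`. -/
theorem Complex.arg_neg_circleMap {r : ℝ} (hr : 0 < r) {θ : ℝ} (hθ : θ ∈ Ioc 0 (2 * π)) :
    (-circleMap 0 r θ).arg = θ - π := by
  have h : -circleMap 0 r θ = r * (cos ((θ - π : ℝ) : ℂ) + sin ((θ - π : ℝ) : ℂ) * I) := by
    rw [circleMap_zero, exp_mul_I, ofReal_sub, cos_sub_pi, sin_sub_pi]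
    ring
  rw [h, arg_mul_cos_add_sin_mul_I hr ⟨by linarith [hθ.1], by linarith [hθ.2]⟩]

theorem integral_sub_pi_mul_exp (n : ℕ) :
    ∫ θ in (0 : ℝ)..(2 * π), ((θ - π : ℝ) : ℂ) * Complex.exp (-(n * θ * Complex.I))
      = 2 * π * (Complex.I / n) := by
  -- For `n = 0` the mean of `θ - π` vanishes, in agreement with the convention `I / 0 = 0`.
  rcases Nat.eq_zero_or_pos n with rfl | hn
  · simp only [Nat.cast_zero, zero_mul, neg_zero, Complex.exp_zero, mul_one, div_zero, mul_zero]
    rw [intervalIntegral.integral_ofReal, Complex.ofReal_eq_zero]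
    rw [intervalIntegral.integral_sub (by simp) (by simp), integral_id,
      intervalIntegral.integral_const, smul_eq_mul]
    ring
  have hn0 : (n : ℂ) ≠ 0 := Nat.cast_ne_zero.2 hn.ne'
  have hI := Complex.I_mul_I
  have hderiv : ∀ θ : ℝ, HasDerivAt (fun θ : ℝ =>
      (((θ : ℂ) - π) * (Complex.I / n) + 1 / (n : ℂ) ^ 2) * Complex.exp (-(n * θ * Complex.I)))
      (((θ - π : ℝ) : ℂ) * Complex.exp (-(n * θ * Complex.I))) θ := by
    intro θ
    have h1 : HasDerivAt (fun θ : ℝ => (θ : ℂ)) 1 θ := Complex.ofRealCLM.hasDerivAt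
    have h2 := ((((h1.sub_const (π : ℂ)).mul_const (Complex.I / n)).add_const
      (1 / (n : ℂ) ^ 2))).mul (((h1.const_mul (n : ℂ)).mul_const Complex.I).neg.cexp)
    refine h2.congr_deriv ?_
    simp only [Pi.neg_apply]
    push_cast
    field_simp
    linear_combination (-(n : ℂ) * (θ - π)) * hI
  rw [intervalIntegral.integral_eq_sub_of_hasDerivAt (fun θ _ => hderiv θ)
    (Continuous.intervalIntegrable (by fun_prop) _ _)]
  have he : Complex.exp (-(n * ((2 * π : ℝ) : ℂ) * Complex.I)) = 1 := by
    rw [Complex.exp_eq_one_iff]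
    exact ⟨-n, by push_cast; ring⟩
  rw [he]
  simp only [Complex.ofReal_zero, mul_zero, zero_mul, neg_zero, Complex.exp_zero]
  push_cast
  ring

/-- The Fourier coefficients of `θ ↦ θ - π` on `(0, 2π)`. -/
theorem integral_arg_neg_circleMap {r : ℝ} (hr : 0 < r) (n : ℕ) :
    ∫ θ in (0 : ℝ)..(2 * π), ((-circleMap 0 r θ).arg : ℂ) * conj (circleMap 0 r θ) ^ n
      = 2 * π * (Complex.I / n) * (r : ℂ) ^ n := by
  rw [← integral_sub_pi_mul_exp, ← intervalIntegral.integral_mul_const]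
  refine intervalIntegral.integral_congr_ae (Eventually.of_forall fun θ hθ => ?_)
  rw [uIoc_of_le (by positivity)] at hθ
  rw [Complex.arg_neg_circleMap hr hθ, circleMap_zero, map_mul, Complex.conj_ofReal,
    ← Complex.exp_conj, mul_pow, ← Complex.exp_nat_mul]
  simp only [map_mul, Complex.conj_ofReal, Complex.conj_I]
  rw [show (n : ℂ) * (θ * -Complex.I) = -(n * θ * Complex.I) by ring]
  ring

/-! ### The test function and the growth norm -/

/-- The moment `∫_0^1 s^{n+1} ω(s) / ν̂(s) ds`. -/
noncomputable def tailMoment (ω ν : ℝ → ℝ) (n : ℕ) : ℝ :=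
  ∫ s in Ioo (0 : ℝ) 1, s ^ (n + 1) * (ω s / tail ν s)

/-- A function of maximal growth in `L^∞_v`, `v = ν̂`, with angular part `θ - π`. -/
noncomputable def argTest (ν : ℝ → ℝ) (ζ : ℂ) : ℂ :=
  (((-ζ).arg / tail ν ‖ζ‖ : ℝ) : ℂ)

theorem ae_discArea_mem : ∀ᵐ ζ ∂discArea, ζ ∈ ball (0 : ℂ) 1 :=
  Measure.ae_smul_measure (ae_restrict_mem measurableSet_ball) _

theorem norm_mem_Ico {ζ : ℂ} (h : ζ ∈ ball (0 : ℂ) 1) : ‖ζ‖ ∈ Ico (0 : ℝ) 1 :=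
  ⟨norm_nonneg _, mem_ball_zero_iff.1 h⟩

theorem IsRadialWeight.continuousOn_tail_norm {ν : ℝ → ℝ} (hν : IsRadialWeight ν) :
    ContinuousOn (fun ζ : ℂ => tail ν ‖ζ‖) (ball 0 1) :=
  hν.continuousOn_tail.comp continuous_norm.continuousOn fun _ h => norm_mem_Ico h

theorem IsRadialWeight.aestronglyMeasurable_inv_tail_norm {ν : ℝ → ℝ} (hν : IsRadialWeight ν) :
    AEStronglyMeasurable (fun ζ : ℂ => (tail ν ‖ζ‖)⁻¹) discArea := by
  refine AEStronglyMeasurable.smul_measure ?_ _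
  exact (hν.continuousOn_tail_norm.inv₀ fun ζ h =>
    (hν.tail_pos _ (norm_mem_Ico h)).ne').aestronglyMeasurable measurableSet_ball

theorem growthNorm_le {v : ℝ → ℝ} {f : ℂ → ℂ} {B : ℝ}
    (h : ∀ ζ ∈ ball (0 : ℂ) 1, ‖f ζ * (v ‖ζ‖ : ℂ)‖ ≤ B) :
    growthNorm v f ≤ ENNReal.ofReal B := by
  unfold growthNorm
  rw [eLpNorm_exponent_top]
  exact eLpNormEssSup_le_of_ae_bound (ae_discArea_mem.mono h)

/-- For continuous functions the essential supremum bounds every value. -/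
theorem norm_mul_le_of_growthNorm_le {v : ℝ → ℝ} {f : ℂ → ℂ} {B : ℝ} (hB : 0 ≤ B)
    (hf : ContinuousOn f (ball 0 1)) (hv : ContinuousOn (fun ζ : ℂ => v ‖ζ‖) (ball 0 1))
    (h : growthNorm v f ≤ ENNReal.ofReal B) {z : ℂ} (hz : z ∈ ball (0 : ℂ) 1) :
    ‖f z * (v ‖z‖ : ℂ)‖ ≤ B := by
  unfold growthNorm at h
  rw [eLpNorm_exponent_top] at h
  set g : ℂ → ℂ := fun ζ => f ζ * (v ‖ζ‖ : ℂ)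
  have hg : ContinuousOn g (ball 0 1) :=
    hf.mul (Complex.continuous_ofReal.comp_continuousOn hv)
  have hae : ∀ᵐ ζ ∂discArea, ‖g ζ‖ ≤ B := by
    filter_upwards [ae_le_eLpNormEssSup (f := g) (μ := discArea)] with ζ hζ
    have := hζ.trans h
    rwa [← ofReal_norm, ENNReal.ofReal_le_ofReal_iff hB] at this
  have hae' : ∀ᵐ ζ, ζ ∈ ball (0 : ℂ) 1 → ‖g ζ‖ ≤ B := by
    rw [← ae_restrict_iff' measurableSet_ball]
    unfold discArea at hae
    rwa [Measure.ae_ennreal_smul_measure_iff (by simp [Real.pi_pos])] at hae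
  -- The set where the bound fails is open and null, hence empty.
  set U : Set ℂ := ball 0 1 ∩ (fun ζ => ‖g ζ‖) ⁻¹' Ioi B
  have hU : IsOpen U := hg.norm.isOpen_inter_preimage isOpen_ball isOpen_Ioi
  have hU0 : volume U = 0 := by
    refine measure_mono_null (fun ζ hζ => ?_) (ae_iff.1 hae')
    exact fun hh => not_lt.2 (hh hζ.1) hζ.2
  have hU1 := (hU.measure_eq_zero_iff volume).1 hU0
  by_contra hcon
  exact (hU1 ▸ notMem_empty z : z ∉ U) ⟨hz, not_le.1 hcon⟩

/-! ### The projection of the test function -/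

section Projection

variable {ω ν : ℝ → ℝ}

theorem norm_argTest_mul_le (hν : IsRadialWeight ν) {ζ : ℂ} (hζ : ζ ∈ ball (0 : ℂ) 1) :
    ‖argTest ν ζ * (tail ν ‖ζ‖ : ℂ)‖ ≤ π := by
  have h0 := hν.tail_pos _ (norm_mem_Ico hζ)
  rw [argTest, ← Complex.ofReal_mul, div_mul_cancel₀ _ h0.ne', Complex.norm_real]
  exact Complex.abs_arg_le_pi _

theorem memGrowth_argTest (hν : IsRadialWeight ν) : MemGrowth (tail ν) (argTest ν) := by
  refine ⟨?_, (growthNorm_le fun ζ => norm_argTest_mul_le hν).trans_lt ENNReal.ofReal_lt_top⟩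
  refine Complex.continuous_ofReal.comp_aestronglyMeasurable ?_
  exact (Complex.measurable_arg.comp measurable_neg).aestronglyMeasurable.mul
    hν.aestronglyMeasurable_inv_tail_norm

/-- Absolute convergence at the origin for the extremal function `1 / ν̂`. -/
theorem BergmanProjectionBounded.integrable_div_tail (hω : IsRadialWeight ω)
    (hν : IsRadialWeight ν) (hP : BergmanProjectionBounded ω (tail ν)) :
    IntegrableOn (fun ζ : ℂ => ω ‖ζ‖ / tail ν ‖ζ‖) (ball 0 1) := by
  obtain ⟨C, hC⟩ := hP
  have hmem : MemGrowth (tail ν) (fun ζ => (((tail ν ‖ζ‖)⁻¹ : ℝ) : ℂ)) := by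
    refine ⟨Complex.continuous_ofReal.comp_aestronglyMeasurable
      hν.aestronglyMeasurable_inv_tail_norm,
      (growthNorm_le (B := 1) fun ζ hζ => ?_).trans_lt ENNReal.ofReal_lt_top⟩
    rw [← Complex.ofReal_mul, inv_mul_cancel₀ (hν.tail_pos _ (norm_mem_Ico hζ)).ne']
    simp
  have h := (hC _ hmem).1 0 (mem_ball_self one_pos)
  have hm := hω.moment_pos 1
  -- The kernel at the origin is constant, so absolute convergence there is exactly integrability of
  -- `ω / ν̂` over the disc.
  have hk : ∀ ζ, bergmanKernel ω 0 ζ = ((1 / (2 * moment ω 1) : ℝ) : ℂ) := by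
    intro ζ
    rw [bergmanKernel, tsum_eq_single 0 fun n hn => by simp [hn]]
    simp
  have h2 := (h.norm.const_mul (2 * moment ω 1))
  refine integrable_discArea_iff.1 (h2.congr ?_)
  filter_upwards [ae_discArea_mem] with ζ hζ
  have h0 := hν.tail_pos _ (norm_mem_Ico hζ)
  have h1 := hω.nonneg _ (norm_mem_Ico hζ)
  rw [hk, norm_mul, norm_mul, RCLike.norm_conj, Complex.norm_real, Complex.norm_real,
    Complex.norm_real, Real.norm_of_nonneg (by positivity), Real.norm_of_nonneg (by positivity),
    Real.norm_of_nonneg h1]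
  field_simp

theorem BergmanProjectionBounded.integrableOn_pow_mul_div_tail (hω : IsRadialWeight ω)
    (hν : IsRadialWeight ν) (hP : BergmanProjectionBounded ω (tail ν)) (n : ℕ) :
    IntegrableOn (fun s => s ^ (n + 1) * (ω s / tail ν s)) (Ioo (0 : ℝ) 1) := by
  have h := hP.integrable_div_tail hω hν
  have h' := (integrableOn_fun_norm_addHaar volume (f := fun s => ω s / tail ν s)).1 h
  have h2 := integrableOn_pow_mul h' n
  refine h2.congr_fun (fun s _ => ?_) measurableSet_Ioo
  simp only [Complex.finrank_real_complex, smul_eq_mul]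
  ring

/-- In polar coordinates the angular integral is a Fourier coefficient of `θ - π`. The Jacobian
contributes the extra power of `r` in `tailMoment`. -/
theorem integral_argTest_mul_conj_pow
    (hI : IntegrableOn (fun ζ : ℂ => argTest ν ζ * (ω ‖ζ‖ : ℂ)) (ball 0 1)) (n : ℕ) :
    ∫ ζ, argTest ν ζ * conj ζ ^ n * (ω ‖ζ‖ : ℂ) ∂discArea
      = 2 * (Complex.I / n) * (tailMoment ω ν n : ℂ) := by
  have hi : IntegrableOn (fun ζ : ℂ => argTest ν ζ * conj ζ ^ n * (ω ‖ζ‖ : ℂ)) (ball 0 1) := by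
    have := hI.bdd_mul (c := 1) (f := fun ζ : ℂ => conj ζ ^ n) (by fun_prop) (by
        filter_upwards [ae_restrict_mem measurableSet_ball] with w hw
        rw [norm_pow, RCLike.norm_conj]
        exact pow_le_one₀ (norm_nonneg _) (mem_ball_zero_iff.1 hw).le)
    refine this.congr (Eventually.of_forall fun ζ => ?_)
    simp only; ring
  rw [integral_discArea_polar hi]
  have h1 : ∀ r ∈ Ioo (0 : ℝ) 1, ∫ θ in (0 : ℝ)..(2 * π), (r : ℂ) *
        (argTest ν (circleMap 0 r θ) * conj (circleMap 0 r θ) ^ n * (ω ‖circleMap 0 r θ‖ : ℂ))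
      = (2 * π * (Complex.I / n)) * ((r ^ (n + 1) * (ω r / tail ν r) : ℝ) : ℂ) := by
    intro r hr
    have : ∀ θ : ℝ, (r : ℂ) *
        (argTest ν (circleMap 0 r θ) * conj (circleMap 0 r θ) ^ n * (ω ‖circleMap 0 r θ‖ : ℂ))
        = ((r : ℂ) * ((ω r / tail ν r : ℝ) : ℂ)) *
          (((-circleMap 0 r θ).arg : ℂ) * conj (circleMap 0 r θ) ^ n) := by
      intro θ
      rw [argTest, norm_circleMap_zero, abs_of_pos hr.1]
      push_cast; ring
    simp_rw [this]
    rw [intervalIntegral.integral_const_mul, integral_arg_neg_circleMap hr.1]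
    push_cast; ring
  rw [setIntegral_congr_fun measurableSet_Ioo h1, integral_const_mul, integral_complex_ofReal,
    tailMoment]
  have hpi : (π : ℂ) ≠ 0 := Complex.ofReal_ne_zero.2 Real.pi_ne_zero
  push_cast
  field_simp

/-- The Taylor expansion of the projection of the test function. -/
theorem hasSum_bergmanProjection_argTest (hω : IsRadialWeight ω)
    (hI : IntegrableOn (fun ζ : ℂ => argTest ν ζ * (ω ‖ζ‖ : ℂ)) (ball 0 1)) {z : ℂ}
    (hz : z ∈ ball (0 : ℂ) 1) :
    HasSum (fun n : ℕ => Complex.I *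
      (z ^ n / n * ((tailMoment ω ν n / moment ω (2 * n + 1) : ℝ) : ℂ)))
      (bergmanProjection ω (argTest ν) z) := by
  have hs := hω.summable_kernel (norm_mem_Ico hz)
  set T : ℕ → ℂ → ℂ := fun n ζ => (conj z * ζ) ^ n / ((2 * moment ω (2 * n + 1) : ℝ) : ℂ)
  set F : ℕ → ℂ → ℂ := fun n ζ => conj (T n ζ) * (argTest ν ζ * (ω ‖ζ‖ : ℂ)) with hF
  have hfi := integrable_discArea_iff.2 hI
  have hT : ∀ n, ∀ᵐ ζ ∂discArea, ‖conj (T n ζ)‖ ≤ ‖z‖ ^ n / (2 * moment ω (2 * n + 1)) := by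
    intro n
    filter_upwards [ae_discArea_mem] with ζ hζ
    rw [RCLike.norm_conj]
    exact norm_kernel_term_le hω z ζ (mem_ball_zero_iff.1 hζ).le n
  have hFi : ∀ n, Integrable (F n) discArea := fun n => hfi.bdd_mul (by fun_prop) (hT n)
  have hFs : Summable fun n => ∫ ζ, ‖F n ζ‖ ∂discArea := by
    refine Summable.of_nonneg_of_le (fun n => integral_nonneg fun _ => norm_nonneg _)
      (fun n => ?_) (hs.mul_right (∫ ζ, ‖argTest ν ζ * (ω ‖ζ‖ : ℂ)‖ ∂discArea))
    rw [← integral_const_mul]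
    refine integral_mono_ae (hFi n).norm (hfi.norm.const_mul _) ?_
    filter_upwards [hT n] with ζ hζ
    rw [hF]
    simp only [norm_mul] at hζ ⊢
    gcongr
  have hsum := hasSum_integral_of_summable_integral_norm hFi hFs
  have hterm : ∀ n, ∫ ζ, F n ζ ∂discArea = Complex.I *
      (z ^ n / n * ((tailMoment ω ν n / moment ω (2 * n + 1) : ℝ) : ℂ)) := by
    intro n
    have hm : (moment ω (2 * n + 1) : ℂ) ≠ 0 :=
      Complex.ofReal_ne_zero.2 (hω.moment_pos (2 * n + 1)).ne'
    have : ∀ ζ, F n ζ = (z ^ n / ((2 * moment ω (2 * n + 1) : ℝ) : ℂ)) *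
        (argTest ν ζ * conj ζ ^ n * (ω ‖ζ‖ : ℂ)) := by
      intro ζ
      simp only [hF, T, map_div₀, map_pow, map_mul, Complex.conj_conj, Complex.conj_ofReal]
      ring
    simp_rw [this]
    rw [integral_const_mul, integral_argTest_mul_conj_pow hI]
    push_cast
    field_simp
  simp_rw [hterm] at hsum
  have hproj : bergmanProjection ω (argTest ν) z = ∫ ζ, ∑' n, F n ζ ∂discArea := by
    unfold bergmanProjection
    congr 1; ext ζ
    rw [bergmanKernel, Complex.conj_tsum, tsum_mul_right]
    ring
  rwa [hproj]

theorem tailMoment_nonneg (hω : IsRadialWeight ω) (hν : IsRadialWeight ν) (n : ℕ) :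
    0 ≤ tailMoment ω ν n := by
  refine setIntegral_nonneg measurableSet_Ioo fun s hs => ?_
  have hs' : s ∈ Ico (0 : ℝ) 1 := ⟨hs.1.le, hs.2⟩
  exact mul_nonneg (pow_nonneg hs.1.le _)
    (div_nonneg (hω.nonneg s hs') (hν.tail_pos s hs').le)

/-- Boundedness of the projection, tested on a function whose Fourier coefficients decay like
`1 / n`. -/
theorem BergmanProjectionBounded.exists_sum_le (hω : IsRadialWeight ω)
    (hν : IsRadialWeight ν) (hP : BergmanProjectionBounded ω (tail ν)) :
    ∃ C : ℝ, 0 < C ∧ ∀ r ∈ Ico (0 : ℝ) 1, ∀ S : Finset ℕ, tail ν r *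
      ∑ n ∈ S, r ^ n / n * (tailMoment ω ν n / moment ω (2 * n + 1)) ≤ C := by
  have hdiv := hP.integrable_div_tail hω hν
  have hI : IntegrableOn (fun ζ : ℂ => argTest ν ζ * (ω ‖ζ‖ : ℂ)) (ball 0 1) := by
    have h1 : IntegrableOn (fun ζ : ℂ => (-ζ).arg * (ω ‖ζ‖ / tail ν ‖ζ‖)) (ball 0 1) :=
      hdiv.bdd_mul (c := π)
        (Complex.measurable_arg.comp measurable_neg).aestronglyMeasurable
        (Eventually.of_forall fun ζ => Complex.abs_arg_le_pi _)
    refine h1.ofReal.congr (Eventually.of_forall fun ζ => ?_)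
    simp only [argTest, Complex.coe_algebraMap]
    push_cast
    ring
  obtain ⟨C, hC⟩ := hP
  have hf := hC _ (memGrowth_argTest hν)
  have hbound : growthNorm (tail ν) (bergmanProjection ω (argTest ν))
      ≤ ENNReal.ofReal (C * π) := by
    refine hf.2.2.trans ?_
    rw [ENNReal.ofReal_mul C.coe_nonneg, ENNReal.ofReal_coe_nnreal]
    gcongr
    exact growthNorm_le fun ζ => norm_argTest_mul_le hν
  -- The summand `1` only makes the constant positive, as `C` may vanish.
  refine ⟨C * π + 1, by positivity, fun r hr S => ?_⟩
  have hrb : (r : ℂ) ∈ ball (0 : ℂ) 1 := by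
    rw [mem_ball_zero_iff, Complex.norm_real, Real.norm_of_nonneg hr.1]
    exact hr.2
  have hv := norm_mul_le_of_growthNorm_le (by positivity) hf.2.1.2.continuousOn
    hν.continuousOn_tail_norm hbound hrb
  rw [Complex.norm_real, Real.norm_of_nonneg hr.1] at hv
  have hsum := (hasSum_bergmanProjection_argTest hω hI hrb)
  -- At a real point all terms are `i` times nonnegative reals, so the imaginary part dominates
  -- every partial sum.
  have hsum' := Complex.imCLM.hasSum hsum
  have hre : ∀ n : ℕ, Complex.imCLM (Complex.I *
      ((r : ℂ) ^ n / n * ((tailMoment ω ν n / moment ω (2 * n + 1) : ℝ) : ℂ)))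
      = r ^ n / n * (tailMoment ω ν n / moment ω (2 * n + 1)) := by
    intro n
    have : (r : ℂ) ^ n / n * ((tailMoment ω ν n / moment ω (2 * n + 1) : ℝ) : ℂ)
        = ((r ^ n / n * (tailMoment ω ν n / moment ω (2 * n + 1)) : ℝ) : ℂ) := by
      push_cast; ring
    rw [this, Complex.imCLM_apply, Complex.I_mul_im, Complex.ofReal_re]
  simp only [hre] at hsum'
  have hnn : ∀ n : ℕ, 0 ≤ r ^ n / n * (tailMoment ω ν n / moment ω (2 * n + 1)) := fun n =>
    mul_nonneg (div_nonneg (pow_nonneg hr.1 _) n.cast_nonneg)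
      (div_nonneg (tailMoment_nonneg hω hν n) (hω.moment_pos _).le)
  have h1 := sum_le_hasSum S (fun n _ => hnn n) hsum'
  have h2 := (h1.trans (le_abs_self _)).trans (Complex.abs_im_le_norm _)
  have h0 := hν.tail_pos r hr
  rw [norm_mul, Complex.norm_real, Real.norm_of_nonneg h0.le] at hv
  nlinarith [mul_le_mul_of_nonneg_left h2 h0.le]

end Projection

/-! ### Estimates for the moments of `ω / ν̂` -/

section TailMoment

variable {ω ν : ℝ → ℝ}

theorem tailMoment_anti (hω : IsRadialWeight ω) (hν : IsRadialWeight ν)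
    (hi : ∀ n : ℕ, IntegrableOn (fun s => s ^ (n + 1) * (ω s / tail ν s)) (Ioo (0 : ℝ) 1)) :
    Antitone (tailMoment ω ν) := by
  intro m n h
  refine setIntegral_mono_on (hi n) (hi m) measurableSet_Ioo fun s hs => ?_
  have hs' : s ∈ Ico (0 : ℝ) 1 := ⟨hs.1.le, hs.2⟩
  exact mul_le_mul_of_nonneg_right (pow_le_pow_of_le_one hs.1.le hs.2.le (by omega))
    (div_nonneg (hω.nonneg s hs') (hν.tail_pos s hs').le)

/-- On `(r, 1)` both `s ^ (n + 1)` and `1 / tail ν s` are at least their values at `r`. -/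
theorem le_tailMoment (hω : IsRadialWeight ω) (hν : IsRadialWeight ν)
    (hi : ∀ n : ℕ, IntegrableOn (fun s => s ^ (n + 1) * (ω s / tail ν s)) (Ioo (0 : ℝ) 1))
    (n : ℕ) {r : ℝ} (hr : r ∈ Ico (0 : ℝ) 1) :
    r ^ (n + 1) * (tail ω r / tail ν r) ≤ tailMoment ω ν n := by
  calc r ^ (n + 1) * (tail ω r / tail ν r)
      = ∫ s in Ioo r 1, r ^ (n + 1) / tail ν r * ω s := by
        rw [integral_const_mul, ← tail_eq_setIntegral ω hr.2.le]
        ring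
    _ ≤ ∫ s in Ioo r 1, s ^ (n + 1) * (ω s / tail ν s) := by
        refine setIntegral_mono_on
          ((hω.integrableOn_Ioo.mono_set (Ioo_subset_Ioo_left hr.1)).const_mul _)
          ((hi n).mono_set (Ioo_subset_Ioo_left hr.1)) measurableSet_Ioo fun s hs => ?_
        have hs' : s ∈ Ico (0 : ℝ) 1 := ⟨hr.1.trans hs.1.le, hs.2⟩
        have h1 := hν.tail_pos s hs'
        have h2 := hν.antitoneOn_tail hr hs' hs.1.le
        have h3 := hω.nonneg s hs'
        have h4 := hr.1
        have h5 := hs.1.le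
        have h6 := hs'.1
        rw [div_mul_eq_mul_div, ← mul_div_assoc]
        gcongr
    _ ≤ tailMoment ω ν n := by
        refine setIntegral_mono_set (hi n) ?_ (Ioo_subset_Ioo_left hr.1).eventuallyLE
        filter_upwards [ae_restrict_mem measurableSet_Ioo] with s hs
        have hs' : s ∈ Ico (0 : ℝ) 1 := ⟨hs.1.le, hs.2⟩
        exact mul_nonneg (pow_nonneg hs.1.le _)
          (div_nonneg (hω.nonneg s hs') (hν.tail_pos s hs').le)

/-- If `s^N ν̂(s) ≤ ε` on `[0, r]`, then the moments of `ω` truncated to `(0, r)` are small. -/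
theorem setIntegral_pow_mul_le_tailMoment (hω : IsRadialWeight ω) (hν : IsRadialWeight ν)
    (hi : ∀ n : ℕ, IntegrableOn (fun s => s ^ (n + 1) * (ω s / tail ν s)) (Ioo (0 : ℝ) 1))
    {N n : ℕ} {r ε : ℝ} (hr : r ∈ Ico (0 : ℝ) 1) (hε : 0 ≤ ε)
    (h : ∀ s ∈ Icc 0 r, s ^ N * tail ν s ≤ ε) :
    ∫ s in Ioo 0 r, s ^ (n + N + 1) * ω s ≤ ε * tailMoment ω ν n := by
  have hnn : ∀ s ∈ Ioo (0 : ℝ) 1, 0 ≤ s ^ (n + 1) * (ω s / tail ν s) := fun s hs => by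
    have hs' : s ∈ Ico (0 : ℝ) 1 := ⟨hs.1.le, hs.2⟩
    exact mul_nonneg (pow_nonneg hs.1.le _)
      (div_nonneg (hω.nonneg s hs') (hν.tail_pos s hs').le)
  calc ∫ s in Ioo 0 r, s ^ (n + N + 1) * ω s
      ≤ ∫ s in Ioo 0 r, ε * (s ^ (n + 1) * (ω s / tail ν s)) := by
        refine setIntegral_mono_on ((integrableOn_pow_mul hω.integrableOn_Ioo _).mono_set
          (Ioo_subset_Ioo_right hr.2.le))
          (((hi n).mono_set (Ioo_subset_Ioo_right hr.2.le)).const_mul _)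
          measurableSet_Ioo fun s hs => ?_
        have hs1 : s ∈ Ioo (0 : ℝ) 1 := ⟨hs.1, hs.2.trans hr.2⟩
        have h1 := hν.tail_pos s ⟨hs1.1.le, hs1.2⟩
        calc s ^ (n + N + 1) * ω s
            = (s ^ N * tail ν s) * (s ^ (n + 1) * (ω s / tail ν s)) := by
              field_simp
              ring
          _ ≤ _ := mul_le_mul_of_nonneg_right (h s ⟨hs.1.le, hs.2.le⟩) (hnn s hs1)
    _ ≤ ε * tailMoment ω ν n := by
        rw [integral_const_mul]
        refine mul_le_mul_of_nonneg_left ?_ hε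
        refine setIntegral_mono_set (hi n) ?_ (Ioo_subset_Ioo_right hr.2.le).eventuallyLE
        filter_upwards [ae_restrict_mem measurableSet_Ioo] with s hs using hnn s hs

/-- The test condition restricted to the frequencies in `[2N, 3N)`. -/
theorem tail_mul_tailMoment_le (hω : IsRadialWeight ω) (hν : IsRadialWeight ν)
    (hi : ∀ n : ℕ, IntegrableOn (fun s => s ^ (n + 1) * (ω s / tail ν s)) (Ioo (0 : ℝ) 1))
    {C : ℝ} (hC : ∀ r ∈ Ico (0 : ℝ) 1, ∀ S : Finset ℕ, tail ν r *
      ∑ n ∈ S, r ^ n / n * (tailMoment ω ν n / moment ω (2 * n + 1)) ≤ C)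
    {N : ℕ} (hN : 1 ≤ N) {r : ℝ} (hr : r ∈ Ico (0 : ℝ) 1) :
    tail ν r * (r ^ (3 * N) * tailMoment ω ν (3 * N)) ≤ 3 * C * moment ω (4 * N + 1) := by
  have hN0 : (0 : ℝ) < N := by exact_mod_cast hN
  have hm := hω.moment_pos (4 * N + 1)
  -- The `N` terms of this block carry `1 / n ≥ 1 / (3N)`, whence the factor `3`. The lower end `2N`
  -- gives the moment of order `4N + 1`.
  have h := hC r hr (Finset.Ico (2 * N) (3 * N))
  have hterm : ∀ n ∈ Finset.Ico (2 * N) (3 * N),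
      r ^ (3 * N) / (3 * N) * (tailMoment ω ν (3 * N) / moment ω (4 * N + 1))
      ≤ r ^ n / n * (tailMoment ω ν n / moment ω (2 * n + 1)) := by
    intro n hn
    rw [Finset.mem_Ico] at hn
    have hn0 : (0 : ℝ) < n := by exact_mod_cast (by omega : 0 < n)
    have hn3 : (n : ℝ) ≤ 3 * N := by exact_mod_cast hn.2.le
    have h1 := tailMoment_anti hω hν hi hn.2.le
    have h2 := hω.moment_anti (show 4 * N + 1 ≤ 2 * n + 1 by omega)
    have h3 := hω.moment_pos (2 * n + 1)
    have h4 := pow_le_pow_of_le_one hr.1 hr.2.le hn.2.le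
    have h5 := pow_nonneg hr.1 n
    have h6 := tailMoment_nonneg hω hν (3 * N)
    have h7 := tailMoment_nonneg hω hν n
    gcongr
  have hsum := Finset.card_nsmul_le_sum _ _ _ hterm
  rw [Nat.card_Ico, nsmul_eq_mul, show 3 * N - 2 * N = N by omega] at hsum
  have h8 := (mul_le_mul_of_nonneg_left hsum (hν.tail_pos r hr).le).trans h
  have h9 : tail ν r * (N * (r ^ (3 * N) / (3 * N) *
      (tailMoment ω ν (3 * N) / moment ω (4 * N + 1))))
      = tail ν r * (r ^ (3 * N) * tailMoment ω ν (3 * N)) / (3 * moment ω (4 * N + 1)) := by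
    field_simp
  rw [h9, div_le_iff₀ (by positivity)] at h8
  linarith

end TailMoment

/-! ### Transfer of upper doubling between the weights -/

section Upper

variable {ω ν : ℝ → ℝ}

theorem upperDoubling_right_of_left (hω : IsRadialWeight ω) (hν : IsRadialWeight ν)
    (hP : BergmanProjectionBounded ω (tail ν)) (hD : UpperDoubling ω) : UpperDoubling ν := by
  have hi := hP.integrableOn_pow_mul_div_tail hω hν
  obtain ⟨C, hC0, hC⟩ := hP.exists_sum_le hω hν
  obtain ⟨D, hD1, hD⟩ := hD.exists_dyadic hω
  obtain ⟨L, M, hL, hM, hLM⟩ := exists_moment_le_tail hω hD1 hD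
  -- The two factors bound below the powers `3N` of the point `k` and `3N + 1` of the point `k + 1`,
  -- where `N = L * 2 ^ k`.
  set c : ℝ := (1 / 4) ^ (3 * L) * (1 / 4) ^ (2 * L)
  have hc : 0 < c := by positivity
  refine upperDoubling_of_dyadic hν (D := 3 * C * M * D / c) (k₀ := 1) fun k hk => ?_
  have h1 := tail_mul_tailMoment_le hω hν hi hC (N := L * 2 ^ k) (Nat.mul_pos hL (by positivity))
    (dyadicPoint_mem k)
  have h2 := le_tailMoment hω hν hi (3 * (L * 2 ^ k)) (dyadicPoint_mem (k + 1))
  have h3 := dyadicPoint_pow_ge hk (L := 3 * L) (n := 3 * (L * 2 ^ k)) (by rw [mul_assoc])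
  have h4 := dyadicPoint_pow_ge (k := k + 1) (by omega) (L := 2 * L) (n := 3 * (L * 2 ^ k) + 1)
    (by
      have : 1 ≤ L * 2 ^ k := Nat.mul_pos hL (by positivity)
      calc 3 * (L * 2 ^ k) + 1 ≤ 4 * (L * 2 ^ k) := by omega
        _ = 2 * L * 2 ^ (k + 1) := by ring)
  have h5 := hLM k (4 * (L * 2 ^ k) + 1) (by omega)
  have ha := hω.tail_dyadicPoint_pos (k + 1)
  have hb := hν.tail_dyadicPoint_pos (k + 1)
  have hb' := hν.tail_dyadicPoint_pos k
  have h6 := hD k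
  set a' := tail ω (dyadicPoint (k + 1))
  set b' := tail ν (dyadicPoint (k + 1))
  set b := tail ν (dyadicPoint k)
  have h7 : b * (c * (a' / b')) ≤ 3 * C * (M * (D * a')) := by
    calc b * (c * (a' / b'))
        = b * ((1 / 4) ^ (3 * L) * ((1 / 4) ^ (2 * L) * (a' / b'))) := by simp only [c]; ring
      _ ≤ b * (dyadicPoint k ^ (3 * (L * 2 ^ k)) *
            (dyadicPoint (k + 1) ^ (3 * (L * 2 ^ k) + 1) * (a' / b'))) := by
          have := pow_nonneg (dyadicPoint_mem k).1 (3 * (L * 2 ^ k))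
          gcongr
      _ ≤ b * (dyadicPoint k ^ (3 * (L * 2 ^ k)) * tailMoment ω ν (3 * (L * 2 ^ k))) := by
          have := pow_nonneg (dyadicPoint_mem k).1 (3 * (L * 2 ^ k))
          gcongr
      _ ≤ 3 * C * moment ω (4 * (L * 2 ^ k) + 1) := h1
      _ ≤ 3 * C * (M * (D * a')) := by
          gcongr
          exact h5.trans (mul_le_mul_of_nonneg_left h6 hM.le)
  have h8 : b * c ≤ 3 * C * M * D * b' := by
    have h9 : b * (c * (a' / b')) = b * c / b' * a' := by ring
    rw [h9, show 3 * C * (M * (D * a')) = 3 * C * M * D * a' by ring] at h7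
    have := le_of_mul_le_mul_right h7 ha
    rwa [div_le_iff₀ hb] at this
  rw [div_mul_eq_mul_div, le_div_iff₀ hc]
  exact h8

/-- Induction on `k`. Below the previous dyadic point, half of the power gains `2⁻ᴸ` and the other
half is the induction hypothesis; beyond it, the power alone is at most `2⁻ᴸ` and the tail is at
most the previous one. One doubling step then costs `D`. -/
theorem pow_mul_tail_le (hν : IsRadialWeight ν) {D : ℝ} (hD1 : 1 ≤ D)
    (hD : ∀ k, tail ν (dyadicPoint k) ≤ D * tail ν (dyadicPoint (k + 1))) {L : ℕ} (hL : 1 ≤ L)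
    (hDL : D * (1 / 2) ^ L ≤ 1) (k : ℕ) :
    ∀ s ∈ Icc 0 (dyadicPoint k),
      s ^ (L * 2 ^ k) * tail ν s ≤ D * (1 / 2) ^ L * tail ν (dyadicPoint k) := by
  induction k with
  | zero =>
    rintro s ⟨h0, h1⟩
    rw [dyadicPoint_zero] at h1 ⊢
    obtain rfl : s = 0 := le_antisymm h1 h0
    rw [zero_pow (by positivity), zero_mul]
    have := hν.tail_pos 0 ⟨le_rfl, one_pos⟩
    positivity
  | succ k ih =>
    rintro s ⟨h0, h1⟩
    have hs : s ∈ Ico (0 : ℝ) 1 := ⟨h0, h1.trans_lt (dyadicPoint_mem _).2⟩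
    have hb := hν.tail_dyadicPoint_pos k
    have hts := hν.tail_pos s hs
    have hsuff : s ^ (L * 2 ^ (k + 1)) * tail ν s ≤ (1 / 2) ^ L * tail ν (dyadicPoint k) := by
      rcases le_total s (dyadicPoint k) with h | h
      · have h2 : s ^ (L * 2 ^ k) ≤ (1 / 2) ^ L :=
          (pow_le_pow_left₀ h0 h _).trans (dyadicPoint_pow_le k L)
        calc s ^ (L * 2 ^ (k + 1)) * tail ν s
            = s ^ (L * 2 ^ k) * (s ^ (L * 2 ^ k) * tail ν s) := by ring
          _ ≤ (1 / 2) ^ L * (D * (1 / 2) ^ L * tail ν (dyadicPoint k)) :=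
              mul_le_mul h2 (ih s ⟨h0, h⟩) (by positivity) (by positivity)
          _ ≤ (1 / 2) ^ L * tail ν (dyadicPoint k) := by
              gcongr
              exact mul_le_of_le_one_left hb.le hDL
      · have h2 : s ^ (L * 2 ^ (k + 1)) ≤ (1 / 2) ^ L :=
          (pow_le_pow_left₀ h0 h1 _).trans (dyadicPoint_pow_le (k + 1) L)
        exact mul_le_mul h2 (hν.antitoneOn_tail (dyadicPoint_mem k) hs h) hts.le (by positivity)
    refine hsuff.trans ?_
    rw [mul_comm D, mul_assoc]
    gcongr
    exact hD k

/-- Since `D < 2 ^ d` for some `d`, the factor `D ^ l` is polynomial in `2 ^ l`, while the other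
factor is exponential in it. -/
theorem exists_pow_mul_half_pow_le (D : ℝ) {ε : ℝ} (hε : 0 < ε) (hD : 1 ≤ D) :
    ∃ l : ℕ, D ^ (l + 1) * (1 / 2 : ℝ) ^ 2 ^ l ≤ ε := by
  obtain ⟨d, hd⟩ := pow_unbounded_of_one_lt D one_lt_two
  have h := ((tendsto_pow_const_mul_const_pow_of_abs_lt_one d
    (by norm_num [abs_lt] : |(1 / 2 : ℝ)| < 1)).comp
    (tendsto_pow_atTop_atTop_of_one_lt one_lt_two)).const_mul D
  rw [mul_zero] at h
  obtain ⟨l, hl⟩ := (h.eventually_le_const hε).exists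
  refine ⟨l, le_trans ?_ hl⟩
  simp only [Function.comp_apply, Nat.cast_pow, Nat.cast_ofNat]
  have h1 : D ^ l ≤ (2 ^ l) ^ d := by
    rw [← pow_mul, mul_comm, pow_mul]
    exact pow_le_pow_left₀ (by linarith) hd.le l
  rw [pow_succ', mul_assoc]
  gcongr

theorem le_pow_mul_add {a : ℕ → ℝ} {D : ℝ} (hD0 : 0 ≤ D) (h : ∀ k, a k ≤ D * a (k + 1))
    (k l : ℕ) : a k ≤ D ^ l * a (k + l) := by
  induction l with
  | zero => simp
  | succ l ih =>
    refine ih.trans ?_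
    rw [pow_succ, mul_assoc]
    gcongr
    exact h (k + l)

/-- With `L = 2 ^ l` the frequency `L * 2 ^ k` is `2 ^ (k + l)`. Testing at the point `k + l` keeps
the powers bounded below independently of `l`; moving `ν̂` there from the point `k` costs only `D ^
l`, against a gain of `2⁻ᴸ`. -/
theorem upperDoubling_left_of_right (hω : IsRadialWeight ω) (hν : IsRadialWeight ν)
    (hP : BergmanProjectionBounded ω (tail ν)) (hD : UpperDoubling ν) : UpperDoubling ω := by
  have hi := hP.integrableOn_pow_mul_div_tail hω hν
  obtain ⟨C, hC0, hC⟩ := hP.exists_sum_le hω hν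
  obtain ⟨D, hD1, hD⟩ := hD.exists_dyadic hν
  -- Here `3 * C` comes from the block estimate, `4 ^ 3` from the power `3N` of the test point, and
  -- `2` leaves half of the moment to be absorbed. The bound by `1` gives `hDL`.
  have hε : 0 < min 1 (1 / (2 * 3 * C * 4 ^ 3)) := by positivity
  obtain ⟨l, hl⟩ := exists_pow_mul_half_pow_le D hε hD1
  have hl1 := hl.trans (min_le_left _ _)
  have hl2 := hl.trans (min_le_right _ _)
  set L := 2 ^ l
  have hL1 : 1 ≤ L := Nat.one_le_two_pow
  have hDL : D * (1 / 2) ^ L ≤ 1 := by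
    refine le_trans ?_ hl1
    gcongr
    exact le_self_pow₀ hD1 l.succ_ne_zero
  have hmom : ∀ k, 1 ≤ k → moment ω (4 * (L * 2 ^ k) + 1) ≤ 2 * tail ω (dyadicPoint k) := by
    intro k hk
    have hN : L * 2 ^ k = 2 ^ (k + l) := by rw [pow_add, mul_comm]
    have h1 := tail_mul_tailMoment_le hω hν hi hC (N := L * 2 ^ k)
      (Nat.mul_pos hL1 (by positivity)) (dyadicPoint_mem (k + l))
    have h2 := dyadicPoint_pow_ge (k := k + l) (by omega) (L := 3) (n := 3 * (L * 2 ^ k))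
      (by rw [hN])
    have h3 := le_pow_mul_add (by linarith) hD k l
    have hb := hν.tail_dyadicPoint_pos k
    have hb' := hν.tail_dyadicPoint_pos (k + l)
    have hm := hω.moment_pos (4 * (L * 2 ^ k) + 1)
    have hH := tailMoment_nonneg hω hν (3 * (L * 2 ^ k))
    have h4 := setIntegral_pow_mul_le_tailMoment hω hν hi (N := L * 2 ^ k)
      (n := 3 * (L * 2 ^ k)) (ε := D * (1 / 2) ^ L * tail ν (dyadicPoint k))
      (dyadicPoint_mem k) (by positivity) (pow_mul_tail_le hν hD1 hD hL1 hDL k)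
    -- The truncated integral now has the order of the moment in the block estimate, which allows
    -- the absorption.
    rw [show 3 * (L * 2 ^ k) + L * 2 ^ k + 1 = 4 * (L * 2 ^ k) + 1 by ring] at h4
    have h5 := hω.moment_le_add_tail (4 * (L * 2 ^ k) + 1) (dyadicPoint_mem k)
    set m := moment ω (4 * (L * 2 ^ k) + 1)
    set H := tailMoment ω ν (3 * (L * 2 ^ k))
    set b := tail ν (dyadicPoint k)
    set b' := tail ν (dyadicPoint (k + l))
    have h6 : b' * H ≤ 4 ^ 3 * (3 * C * m) := by
      have : b' * ((1 / 4) ^ 3 * H) ≤ 3 * C * m := le_trans (by gcongr) h1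
      linarith
    have h7 : D * (1 / 2) ^ L * b * H ≤ 1 / 2 * m := by
      calc D * (1 / 2) ^ L * b * H
          ≤ D * (1 / 2) ^ L * (D ^ l * b') * H := by gcongr
        _ = (D ^ (l + 1) * (1 / 2) ^ L) * (b' * H) := by ring
        _ ≤ (1 / (2 * 3 * C * 4 ^ 3)) * (4 ^ 3 * (3 * C * m)) := by gcongr
        _ = 1 / 2 * m := by field_simp
    linarith
  -- The moment bound at `k + 1` has order `8 * (L * 2 ^ k) + 1 ≤ 9 * (L * 2 ^ k)`.
  set c : ℝ := (1 / 4) ^ (9 * L)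
  have hc : 0 < c := by positivity
  refine upperDoubling_of_dyadic hω (D := 2 / c) (k₀ := 1) fun k hk => ?_
  have h1 := hω.moment_ge (4 * (L * 2 ^ (k + 1)) + 1) (dyadicPoint_mem k)
  have h2 := dyadicPoint_pow_ge hk (L := 9 * L) (n := 4 * (L * 2 ^ (k + 1)) + 1) (by
    have : 1 ≤ L * 2 ^ k := Nat.mul_pos hL1 (by positivity)
    calc 4 * (L * 2 ^ (k + 1)) + 1 = 8 * (L * 2 ^ k) + 1 := by ring
      _ ≤ 9 * (L * 2 ^ k) := by omega
      _ = 9 * L * 2 ^ k := by ring)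
  have h3 := hmom (k + 1) (by omega)
  have ha := hω.tail_dyadicPoint_pos k
  rw [div_mul_eq_mul_div, le_div_iff₀ hc]
  nlinarith [mul_le_mul_of_nonneg_right h2 ha.le]

end Upper

/-! ### Lower doubling of both weights -/

section Lower

variable {ω ν : ℝ → ℝ}

/-- Lower bounds on the dyadic blocks `[L 2ᵏ, L 2ᵏ⁺¹)` of a series add up. -/
theorem sum_le_sum_dyadic_blocks {t q : ℕ → ℝ} {L K : ℕ}
    (h : ∀ k < K, q k ≤ ∑ n ∈ Finset.Ico (L * 2 ^ k) (L * 2 ^ (k + 1)), t n) :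
    ∑ k ∈ Finset.range K, q k ≤ ∑ n ∈ Finset.Ico L (L * 2 ^ K), t n := by
  induction K with
  | zero => simp
  | succ K ih =>
    rw [Finset.sum_range_succ, ← Finset.sum_Ico_consecutive t
      (Nat.le_mul_of_pos_right L (by positivity : 0 < 2 ^ K))
      (Nat.mul_le_mul_left L (Nat.pow_le_pow_right two_pos K.le_succ))]
    exact add_le_add (ih fun k hk => h k (by omega)) (h K (by omega))

/-- The test condition at a dyadic point, bounded below block by block. -/
theorem exists_dyadic_sum_le (hω : IsRadialWeight ω) (hν : IsRadialWeight ν)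
    (hP : BergmanProjectionBounded ω (tail ν)) (hD : UpperDoubling ω) :
    ∃ C : ℝ, ∀ K, 1 ≤ K → ∀ j : ℕ → ℕ, (∀ k < K, k + 1 ≤ j k) →
      tail ν (dyadicPoint K) * ∑ k ∈ Finset.range K,
        tail ω (dyadicPoint (j k)) /
          (tail ν (dyadicPoint (j k)) * tail ω (dyadicPoint (k + 1))) ≤ C := by
  have hi := hP.integrableOn_pow_mul_div_tail hω hν
  obtain ⟨C, hC0, hC⟩ := hP.exists_sum_le hω hν
  obtain ⟨D, hD1, hD⟩ := hD.exists_dyadic hω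
  obtain ⟨L, M, hL, hM, hLM⟩ := exists_moment_le_tail hω hD1 hD
  -- The two powers of `1 / 4` bound below the `n`-th power of the point `K` and the `(n + 1)`-st
  -- power of the point `j k`, the latter because `k + 1 ≤ j k`. The block has `L * 2 ^ k` terms
  -- with `1 / n ≥ 1 / (2 * L * 2 ^ k)`, whence the `2`.
  set c : ℝ := (1 / 4) ^ L * (1 / 4) ^ L / (2 * M) with hcdef
  have hc : 0 < c := by positivity
  refine ⟨C / c, fun K hK j hj => ?_⟩
  set x : ℕ → ℝ := fun k => tail ω (dyadicPoint (j k)) /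
    (tail ν (dyadicPoint (j k)) * tail ω (dyadicPoint (k + 1)))
  have hblock : ∀ k < K, c * x k ≤ ∑ n ∈ Finset.Ico (L * 2 ^ k) (L * 2 ^ (k + 1)),
      dyadicPoint K ^ n / n * (tailMoment ω ν n / moment ω (2 * n + 1)) := by
    intro k hk
    have hR : 0 < L * 2 ^ k := Nat.mul_pos hL (by positivity)
    have hR0 : (0 : ℝ) < (L * 2 ^ k : ℕ) := by exact_mod_cast hR
    have ha := hω.tail_dyadicPoint_pos (j k)
    have hb := hν.tail_dyadicPoint_pos (j k)
    have ha' := hω.tail_dyadicPoint_pos (k + 1)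
    have hterm : ∀ n ∈ Finset.Ico (L * 2 ^ k) (L * 2 ^ (k + 1)),
        (1 / 4 : ℝ) ^ L / (2 * (L * 2 ^ k : ℕ)) *
          ((1 / 4) ^ L * (tail ω (dyadicPoint (j k)) / tail ν (dyadicPoint (j k))) /
            (M * tail ω (dyadicPoint (k + 1))))
        ≤ dyadicPoint K ^ n / n * (tailMoment ω ν n / moment ω (2 * n + 1)) := by
      intro n hn
      rw [Finset.mem_Ico] at hn
      have hn0 : (0 : ℝ) < n := by exact_mod_cast hR.trans_le hn.1
      have hn2 : (n : ℝ) ≤ 2 * (L * 2 ^ k : ℕ) := by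
        have : n ≤ 2 * (L * 2 ^ k) := by
          refine hn.2.le.trans (le_of_eq ?_)
          ring
        exact_mod_cast this
      have h1 := dyadicPoint_pow_ge hK (L := L) (n := n)
        (hn.2.le.trans (Nat.mul_le_mul_left L (Nat.pow_le_pow_right two_pos hk)))
      have h2 := dyadicPoint_pow_ge (k := j k) (by have := hj k hk; omega) (L := L) (n := n + 1)
        (hn.2.trans_le (Nat.mul_le_mul_left L (Nat.pow_le_pow_right two_pos (hj k hk))))
      have h3 := le_tailMoment hω hν hi n (dyadicPoint_mem (j k))
      have h4 := hLM (k + 1) (2 * n + 1) (by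
        rw [pow_succ, ← mul_assoc]
        omega)
      have h5 := hω.moment_pos (2 * n + 1)
      have h6 : (1 / 4 : ℝ) ^ L * (tail ω (dyadicPoint (j k)) / tail ν (dyadicPoint (j k)))
          ≤ tailMoment ω ν n := le_trans (by gcongr) h3
      have h7 := pow_nonneg (dyadicPoint_mem K).1 n
      have h8 := tailMoment_nonneg hω hν n
      gcongr
    have hsum := Finset.card_nsmul_le_sum _ _ _ hterm
    rw [Nat.card_Ico, nsmul_eq_mul,
      show L * 2 ^ (k + 1) - L * 2 ^ k = L * 2 ^ k by rw [pow_succ, ← mul_assoc]; omega] at hsum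
    refine le_trans (le_of_eq ?_) hsum
    simp only [hcdef, x]
    generalize ((L * 2 ^ k : ℕ) : ℝ) = R at hR0 ⊢
    field_simp
  have h1 := sum_le_sum_dyadic_blocks hblock
  rw [← Finset.mul_sum] at h1
  have h2 := (mul_le_mul_of_nonneg_left h1 (hν.tail_dyadicPoint_pos K).le).trans
    (hC _ (dyadicPoint_mem K) _)
  rw [le_div_iff₀ hc]
  linarith

/-- With `j k = K` for all `k` the tails of `ν` cancel. -/
theorem lowerDoubling_left (hω : IsRadialWeight ω) (hν : IsRadialWeight ν)
    (hP : BergmanProjectionBounded ω (tail ν)) (hD : UpperDoubling ω) : LowerDoubling ω := by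
  obtain ⟨C, hC⟩ := exists_dyadic_sum_le hω hν hP hD
  obtain ⟨p, hp⟩ := exists_two_mul_le_of_sum_inv_le hω.tail_dyadicPoint_pos
    hω.tail_dyadicPoint_anti (C := C) fun K hK => by
      refine le_trans (le_of_eq ?_) (hC K hK (fun _ => K) fun k hk => hk)
      rw [Finset.mul_sum, Finset.mul_sum]
      refine Finset.sum_congr rfl fun k _ => ?_
      have h1 := (hν.tail_dyadicPoint_pos K).ne'
      have h2 := (hω.tail_dyadicPoint_pos (k + 1)).ne'
      field_simp
  exact lowerDoubling_of_dyadic hω hp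

/-- With `j k = k + 1` the tails of `ω` cancel in every term. -/
theorem lowerDoubling_right (hω : IsRadialWeight ω) (hν : IsRadialWeight ν)
    (hP : BergmanProjectionBounded ω (tail ν)) (hD : UpperDoubling ω) : LowerDoubling ν := by
  obtain ⟨C, hC⟩ := exists_dyadic_sum_le hω hν hP hD
  obtain ⟨p, hp⟩ := exists_two_mul_le_of_sum_inv_le hν.tail_dyadicPoint_pos
    hν.tail_dyadicPoint_anti (C := C) fun K hK => by
      refine le_trans (le_of_eq ?_) (hC K hK (fun k => k + 1) fun k _ => le_rfl)
      congr 1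
      refine Finset.sum_congr rfl fun k _ => ?_
      have h1 := (hν.tail_dyadicPoint_pos (k + 1)).ne'
      have h2 := (hω.tail_dyadicPoint_pos (k + 1)).ne'
      field_simp
  exact lowerDoubling_of_dyadic hν hp

end Lower

/-! ### The main theorem -/

theorem mainTheorem9 (ω ν : ℝ → ℝ) (hω : IsRadialWeight ω) (hν : IsRadialWeight ν)
    (hP : BergmanProjectionBounded ω (tail ν))
    (hD : UpperDoubling ω ∨ UpperDoubling ν) :
    Doubling ω ∧ Doubling ν := by
  have hωD : UpperDoubling ω := hD.elim id (upperDoubling_left_of_right hω hν hP)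
  exact ⟨⟨hωD, lowerDoubling_left hω hν hP hωD⟩,
    upperDoubling_right_of_left hω hν hP hωD, lowerDoubling_right hω hν hP hωD⟩
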